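/- Let $\mathbf k$ be an algebraically closed field of characteristic $0$ and let $H$ be a cocommutative Hopf algebra over $\mathbf k$ with comultiplication $\Delta$, counit $\varepsilon$ and antipode $S$, and write $\Delta(h)=h_{(1)}\otimes h_{(2)}$, $h_{(-1)}=S(h_{(1)})$, $h_{(-2)}=S(h_{(2)})$. For a left $H$-module $M$ let $H^{\otimes n}\otimes_H M$ be formed with the right $H$-action on $H^{\otimes n}$ through the iterated comultiplication. *Definitions.* A *Lie $H$-pseudoalgebra* is a left $H$-module $L$ with a bilinear map $L\times L\to (H\otimes H)\otimes_H L$, $(a,b)\mapsto[a*b]$, such that $[fa*gb]=((f\otimes g)\otimes_H1)[a*b]$, $[b*a]=-(\sigma\otimes_H\mathrm{id})[a*b]$ with $\sigma(f\otimes g)=g\otimes f$, and $[a*[b*c]]-((\sigma\otimes\mathrm{id})\otimes_H\mathrm{id})[b*[a*c]]=[[a*b]*c]$ in $H^{\otimes3}\otimes_HL$. Here, if $[b*c]=\sum_i(h_i\otimes l_i)\otimes_Hd_i$ and $[a*d_i]=\sum_j(h_{ij}\otimes l_{ij})\otimes_Hd_{ij}$, then $[a*[b*c]]=\sum_{i,j}(h_{ij}\otimes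 h_i l_{ij(1)}\otimes l_i l_{ij(2)})\otimes_Hd_{ij}$. If $[a*b]=\sum_i(f_i\otimes g_i)\otimes_He_i$ and $[e_i*c]=\sum_j(f_{ij}\otimes g_{ij})\otimes_He_{ij}$, then $[[a*b]*c]=\sum_{i,j}(f_if_{ij(1)}\otimes g_if_{ij(2)}\otimes g_{ij})\otimes_He_{ij}$. A *Lie $H$-coalgebra* is a left $H$-module $R$ with an $H$-linear map $\delta:R\to\wedge^2R\subset R\otimes R$ (skew-symmetric tensors; $H$ acts on $R\otimes R$ through $\Delta$) such that $(\mathrm{id}\otimes\delta)\delta-\tau_{12}(\mathrm{id}\otimes\delta)\delta=(\delta\otimes\mathrm{id})\delta$, where $\tau_{12}$ interchanges the first two tensor factors. It is *finite* if $R$ is a finitely generated $H$-module. The *pseudo-dual* $V^*=\mathrm{Chom}(V,\mathbf k)$ of a left $H$-module $V$ is the space of $\mathbf k$-linear maps $\phi:V\to(H\otimes H)\otimes_H\mathbf k$ ($H$ acts on $\mathbf k$ by $\varepsilon$) with $\phi(hv)=((1\otimes h)\otimes_H1)\phi(v)$; it is a left $H$-module by $(h\phi)(v)=((h\otimes1)\otimes_H1)\phi(v)$.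 Let $X=\mathrm{Hom}_{\mathbf k}(H,\mathbf k)$, with product $\langle xy,f\rangle=\langle x,f_{(1)}\rangle\langle y,f_{(2)}\rangle$, antipode $\langle S(x),h\rangle=\langle x,S(h)\rangle$, actions $\langle hx,f\rangle=\langle x,S(h)f\rangle$ and $\langle xh,f\rangle=\langle x,fS(h)\rangle$, and comultiplication $\Delta(x)=x_{(1)}\otimes x_{(2)}\in(H\otimes H)^*$, $\langle\Delta(x),f\otimes g\rangle=\langle x,fg\rangle$; put $x_{(-1)}=S(x_{(1)})$. If $\{h_i\}$ is a basis of $H$ and $x_i\in X$ are given by $\langle x_i,h_j\rangle=\delta_{ij}$, an expression $\Phi(x_{(1)},x_{(2)})$ with $\Phi$ bilinear means $\sum_{i,j}\langle x,h_ih_j\rangle\Phi(x_i,x_j)$; below only finitely many terms are nonzero, and the result does not depend on the basis. The Fourier coefficients of $\phi\in V^*$ are $\phi_xv=\sum_i\langle S(x),f_i\,g_{i(-1)}\rangle\, g_{i(2)}c_i\in\mathbf k$ if $\phi(v)=\sum_i(f_i\otimes g_i)\otimes_Hc_i$. The $x$-brackets of a Lie $H$-pseudoalgebra are $[a_xb]=\sum_i\langle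 S(x),f_i\,g_{i(-1)}\rangle\, g_{i(2)}e_i$ if $[a*b]=\sum_i(f_i\otimes g_i)\otimes_He_i$. A *Lie $H$-conformal algebra* is a left $H$-module $L$ with $x$-brackets $[a_xb]\in L$, $\mathbf k$-linear in $a,b\in L$ and $x\in X$, such that $\operatorname{codim}\{x\in X:[a_xb]=0\}<\infty$; $[(ha)_xb]=[a_{xh}b]$; $[a_x(hb)]=h_{(2)}[a_{h_{(-1)}x}b]$; $[a_xb]=-\sum_i\langle x,h_{i(-1)}\rangle h_{i(-2)}[b_{x_i}a]$; and $[a_x[b_yc]]-[b_y[a_xc]]=[[a_{x_{(2)}}b]_{y x_{(1)}}c]$. **Theorem.** (a) Let $L=\bigoplus_{i=1}^NHa_i$ be a Lie $H$-pseudoalgebra that is free of finite rank over $H$, with $[a_i*a_j]=\sum_k(h^{ij}_k\otimes l^{ij}_k)\otimes_Ha_k$ (where $h^{ij}_k\otimes l^{ij}_k$ stands for an element, i.e. a finite sum of such tensors, of $H\otimes H$). Then $L^*$ is a free $H$-module with basis $a^1,\dots,a^N$ given by $a^i(a_j)=(1\otimes1)\otimes_H\delta_{ij}$. There is a unique map $\delta:L^*\to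 L^*\otimes L^*$ with $$\delta(a^k)=\sum_{i,j}S(h^{ij}_k)a^i\otimes S(l^{ij}_k)a^j,\qquad \delta(ha^k)=\Delta(h)\delta(a^k),$$ extended linearly, and $(L^*,\delta)$ is a Lie $H$-coalgebra. (b) Conversely, let $(R,\delta)$ be a finite Lie $H$-coalgebra, and write $\delta(r)=\sum r_{(1)}\otimes r_{(2)}$. Then there are unique $x$-brackets on $R^*$ (elements $[f_xg]\in R^*$ for $f,g\in R^*$, $x\in X$) whose Fourier coefficients are $$[f_xg]_y(r)=\sum f_{x_{(2)}}(r_{(1)})\,g_{y x_{(-1)}}(r_{(2)})\qquad(r\in R,\ y\in X).$$ They make $R^*$ a Lie $H$-conformal algebra. Moreover, they are the $x$-brackets of a unique Lie $H$-pseudoalgebra structure on $R^*$. -/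

import Mathlib

open scoped TensorProduct

universe v

namespace HPseudo

section Relative

/-! ### The relative tensor product `A ⊗_H M`

`A` is a `k`-algebra, regarded as a right `H`-module through an algebra homomorphism
`Δ : H → A`, and `M` is a left `H`-module.  (Mathlib's tensor product is only available over
commutative rings.)  -/

variable {k H A B : Type*} [Field k] [Ring H] [Algebra k H] [Ring A] [Algebra k A]
  [Ring B] [Algebra k B]

/-- The left `A`-submodule of `A ⊗_k M` generated by the elements `a Δ(h) ⊗ m - a ⊗ h m`. -/
def relSpan (Δ : H →ₐ[k] A) (M : Type*) [AddCommGroup M] [Module k M] [Module H M] :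
    Submodule A (A ⊗[k] M) :=
  Submodule.span A {z | ∃ (a : A) (h : H) (m : M), z = (a * Δ h) ⊗ₜ[k] m - a ⊗ₜ[k] (h • m)}

/-- `A ⊗_H M`, where `H` acts on `A` from the right by `a · h = a Δ(h)`. -/
def RelTensor (Δ : H →ₐ[k] A) (M : Type*) [AddCommGroup M] [Module k M] [Module H M] : Type _ :=
  (A ⊗[k] M) ⧸ relSpan Δ M

namespace RelTensor

variable (Δ : H →ₐ[k] A) (M : Type*) [AddCommGroup M] [Module k M] [Module H M]

noncomputable instance : AddCommGroup (RelTensor Δ M) :=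
  inferInstanceAs (AddCommGroup ((A ⊗[k] M) ⧸ relSpan Δ M))

/-- The left `A`-module structure `a (b ⊗_H m) = (a b) ⊗_H m`. -/
noncomputable instance : Module A (RelTensor Δ M) :=
  inferInstanceAs (Module A ((A ⊗[k] M) ⧸ relSpan Δ M))

noncomputable instance : Module k (RelTensor Δ M) :=
  inferInstanceAs (Module k ((A ⊗[k] M) ⧸ relSpan Δ M))

instance : IsScalarTower k A (RelTensor Δ M) :=
  inferInstanceAs (IsScalarTower k A ((A ⊗[k] M) ⧸ relSpan Δ M))

/-- The quotient map `A ⊗_k M → A ⊗_H M`. -/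
noncomputable def proj : A ⊗[k] M →ₗ[k] RelTensor Δ M :=
  ((relSpan Δ M).mkQ).restrictScalars k

variable {M}

/-- The element `a ⊗_H m`. -/
noncomputable def tmul (a : A) (m : M) : RelTensor Δ M := proj Δ M (a ⊗ₜ[k] m)

variable {Δ}

theorem smul_tmul (a b : A) (m : M) : a • tmul Δ b m = tmul Δ (a * b) m := rfl

theorem tmul_balanced (a : A) (h : H) (m : M) : tmul Δ (a * Δ h) m = tmul Δ a (h • m) := by
  refine (Submodule.Quotient.eq (relSpan Δ M)).2 ?_
  exact Submodule.subset_span ⟨a, h, m, rfl⟩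

/-- The universal property: a `k`-linear map on `A ⊗_k M` that is balanced over `H` descends to
`A ⊗_H M`. -/
noncomputable def lift {Q : Type*} [AddCommGroup Q] [Module k Q] (φ : A ⊗[k] M →ₗ[k] Q)
    (hφ : ∀ (a : A) (h : H) (m : M), φ ((a * Δ h) ⊗ₜ[k] m) = φ (a ⊗ₜ[k] (h • m))) :
    RelTensor Δ M →ₗ[k] Q :=
  Submodule.liftQ ((relSpan Δ M).restrictScalars k) φ <| by
    intro z hz
    have key : ∀ a : A, φ (a • z) = 0 := by
      refine Submodule.span_induction (p := fun z _ => ∀ a : A, φ (a • z) = 0) ?_ ?_ ?_ ?_ hz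
      · rintro _ ⟨b, h, m, rfl⟩ a
        rw [smul_sub, TensorProduct.smul_tmul', TensorProduct.smul_tmul', map_sub, smul_eq_mul,
          smul_eq_mul, ← mul_assoc, hφ, sub_self]
      · intro a
        rw [smul_zero, map_zero]
      · intro x y _ _ hx hy a
        rw [smul_add, map_add, hx, hy, add_zero]
      · intro b x _ hx a
        rw [smul_smul]
        exact hx _
    have h1 := key 1
    rw [one_smul] at h1
    exact h1

@[simp] theorem lift_tmul {Q : Type*} [AddCommGroup Q] [Module k Q] (φ : A ⊗[k] M →ₗ[k] Q)
    (hφ : ∀ (a : A) (h : H) (m : M), φ ((a * Δ h) ⊗ₜ[k] m) = φ (a ⊗ₜ[k] (h • m)))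
    (a : A) (m : M) : lift φ hφ (tmul Δ a m) = φ (a ⊗ₜ[k] m) := rfl

/-- The map `F ⊗_H id : A ⊗_H M → B ⊗_H M` induced by an algebra homomorphism `F : A → B`
compatible with the maps from `H`. -/
noncomputable def map {Δ' : H →ₐ[k] B} (F : A →ₐ[k] B) (hF : ∀ h, F (Δ h) = Δ' h) (M : Type*)
    [AddCommGroup M] [Module k M] [Module H M] : RelTensor Δ M →ₗ[k] RelTensor Δ' M :=
  lift ((proj Δ' M).comp (F.toLinearMap.rTensor M)) <| by
    intro a h m
    simp only [LinearMap.comp_apply, LinearMap.rTensor_tmul, AlgHom.toLinearMap_apply, map_mul, hF]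
    exact tmul_balanced _ _ _

@[simp] theorem map_tmul {Δ' : H →ₐ[k] B} (F : A →ₐ[k] B) (hF : ∀ h, F (Δ h) = Δ' h)
    (a : A) (m : M) : map F hF M (tmul Δ a m) = tmul Δ' (F a) m := rfl

theorem induction {p : RelTensor Δ M → Prop} (h0 : p 0) (ht : ∀ a m, p (tmul Δ a m))
    (ha : ∀ x y, p x → p y → p (x + y)) (x : RelTensor Δ M) : p x := by
  obtain ⟨z, rfl⟩ := Submodule.mkQ_surjective (relSpan Δ M) x
  induction z using TensorProduct.induction_on with
  | zero => rw [map_zero]; exact h0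
  | tmul a m => exact ht a m
  | add x y hx hy => rw [map_add]; exact ha _ _ hx hy

theorem map_smul' {Δ' : H →ₐ[k] B} (F : A →ₐ[k] B) (hF : ∀ h, F (Δ h) = Δ' h) (a : A)
    (x : RelTensor Δ M) : map F hF M (a • x) = F a • map F hF M x := by
  induction x using RelTensor.induction with
  | h0 => simp only [smul_zero, map_zero]
  | ht b m => rw [smul_tmul, map_tmul, map_tmul, smul_tmul, map_mul]
  | ha x y hx hy => rw [smul_add, map_add, map_add, hx, hy, smul_add]

end RelTensor

end Relative

section Hopf

variable (k H : Type*) [Field k] [Ring H] [HopfAlgebra k H]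

/-! ### Hopf algebra preliminaries -/

/-- The comultiplication `Δ : H → H ⊗ H` as an algebra homomorphism. -/
noncomputable abbrev Δ₂ : H →ₐ[k] H ⊗[k] H := Bialgebra.comulAlgHom k H

/-- The map `id ⊗ Δ : H ⊗ H → H ⊗ H ⊗ H`. -/
noncomputable def idΔ : H ⊗[k] H →ₐ[k] H ⊗[k] (H ⊗[k] H) :=
  Algebra.TensorProduct.map (AlgHom.id k H) (Δ₂ k H)

/-- The map `Δ ⊗ id : H ⊗ H → H ⊗ H ⊗ H`. -/
noncomputable def Δid : H ⊗[k] H →ₐ[k] H ⊗[k] (H ⊗[k] H) :=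
  (Algebra.TensorProduct.assoc k k k H H H).toAlgHom.comp
    (Algebra.TensorProduct.map (Δ₂ k H) (AlgHom.id k H))

/-- The iterated comultiplication `H → H ⊗ H ⊗ H`. -/
noncomputable def Δ₃ : H →ₐ[k] H ⊗[k] (H ⊗[k] H) := (idΔ k H).comp (Δ₂ k H)

variable {H}

theorem idΔ_comul (h : H) : idΔ k H (Δ₂ k H h) = Δ₃ k H h := rfl

theorem Δid_comul (h : H) : Δid k H (Δ₂ k H h) = Δ₃ k H h := Coalgebra.coassoc_apply (R := k) h

theorem comm_comul [Coalgebra.IsCocomm k H] (h : H) :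
    Algebra.TensorProduct.comm k H H (Δ₂ k H h) = Δ₂ k H h := Coalgebra.comm_comul k h

theorem leftComm_comul [Coalgebra.IsCocomm k H] (h : H) :
    Algebra.TensorProduct.leftComm k H H H (Δ₃ k H h) = Δ₃ k H h := by
  rw [← Δid_comul]
  have key : ∀ z : H ⊗[k] H, Algebra.TensorProduct.leftComm k H H H
      (Algebra.TensorProduct.assoc k k k H H H
        (Algebra.TensorProduct.map (Δ₂ k H) (AlgHom.id k H) z)) =
      Algebra.TensorProduct.assoc k k k H H H
        (Algebra.TensorProduct.map (Δ₂ k H) (AlgHom.id k H) z) := by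
    intro z
    induction z using TensorProduct.induction_on with
    | zero => simp only [map_zero]
    | add x y hx hy => simp only [map_add, hx, hy]
    | tmul a b =>
      have aux : ∀ w : H ⊗[k] H, Algebra.TensorProduct.leftComm k H H H
          (Algebra.TensorProduct.assoc k k k H H H (w ⊗ₜ[k] b)) =
          Algebra.TensorProduct.assoc k k k H H H
            ((Algebra.TensorProduct.comm k H H w) ⊗ₜ[k] b) := by
        intro w
        induction w using TensorProduct.induction_on with
        | zero => simp only [TensorProduct.zero_tmul, map_zero]
        | add x y hx hy => simp only [TensorProduct.add_tmul, map_add, hx, hy]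
        | tmul c d => rfl
      rw [Algebra.TensorProduct.map_tmul]
      exact (aux _).trans (by rw [comm_comul]; rfl)
  exact key _

/-- The dual `X = H^*`. -/
abbrev X (k H : Type*) [Field k] [Ring H] [HopfAlgebra k H] : Type _ := Module.Dual k H

variable {k}

namespace X

/-- The product of `X`: `⟨x y, f⟩ = ⟨x, f₍₁₎⟩ ⟨y, f₍₂₎⟩`. -/
noncomputable def mul (x y : X k H) : X k H :=
  (TensorProduct.lid k k).toLinearMap ∘ₗ TensorProduct.map x y ∘ₗ Coalgebra.comul

/-- The antipode of `X`: `⟨S(x), h⟩ = ⟨x, S(h)⟩`. -/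
noncomputable def antip (x : X k H) : X k H := x ∘ₗ HopfAlgebra.antipode k

/-- The left action of `H` on `X`: `⟨h x, f⟩ = ⟨x, S(h) f⟩`. -/
noncomputable def lact (h : H) (x : X k H) : X k H :=
  x ∘ₗ LinearMap.mulLeft k (HopfAlgebra.antipode k h)

/-- The right action of `H` on `X`: `⟨x h, f⟩ = ⟨x, f S(h)⟩`. -/
noncomputable def ract (x : X k H) (h : H) : X k H :=
  x ∘ₗ LinearMap.mulRight k (HopfAlgebra.antipode k h)

/-- The comultiplication of `X` with values in the completed tensor product
`X ⊗̂ X = (H ⊗ H)^*`: `⟨Δ(x), f ⊗ g⟩ = ⟨x, f g⟩`. -/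
noncomputable def comul (x : X k H) : Module.Dual k (H ⊗[k] H) := x ∘ₗ LinearMap.mul' k H

end X

/-- `s` is the sum of the family `f`, all but finitely many members of which vanish. -/
def IsFiniteSum {ι M : Type*} [AddCommMonoid M] (f : ι → M) (s : M) : Prop :=
  (Function.support f).Finite ∧ ∑ᶠ i, f i = s

/-- `s = Φ(x₍₁₎, x₍₂₎)`.  Here `Δ(x) ∈ X ⊗̂ X` is expanded along the elements `x_i` of `X` dual to
a basis `h_i` of `H`, that is `Δ(x) = ∑_{i,j} ⟨Δ(x), h_i ⊗ h_j⟩ x_i ⊗ x_j`, and `Φ` is applied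
term by term; only finitely many terms are nonzero. -/
def IsSweedlerSum {ι M : Type*} [AddCommGroup M] [Module k M] (b : Module.Basis ι k H)
    (x : X k H) (Φ : X k H → X k H → M) (s : M) : Prop :=
  IsFiniteSum (fun p : ι × ι => X.comul x (b p.1 ⊗ₜ[k] b p.2) • Φ (b.coord p.1) (b.coord p.2)) s

/-- The action of `H ⊗ H` on `M ⊗ N`: `(f ⊗ g)(m ⊗ n) = f m ⊗ g n`. -/
noncomputable def outerAct {M N : Type*} [AddCommGroup M] [Module k M] [Module H M]
    [IsScalarTower k H M] [AddCommGroup N] [Module k N] [Module H N] [IsScalarTower k H N] :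
    H ⊗[k] H →ₗ[k] (M ⊗[k] N →ₗ[k] M ⊗[k] N) :=
  TensorProduct.lift (LinearMap.mk₂ k
    (fun f g => TensorProduct.map (Algebra.lsmul k k M f) (Algebra.lsmul k k N g))
    (fun f f' g => by rw [map_add, TensorProduct.map_add_left])
    (fun c f g => by rw [map_smul, TensorProduct.map_smul_left])
    (fun f g g' => by rw [map_add, TensorProduct.map_add_right])
    (fun c f g => by rw [map_smul, TensorProduct.map_smul_right]))

/-- The diagonal action of `H` on `M ⊗ N`: `h (m ⊗ n) = h₍₁₎ m ⊗ h₍₂₎ n`. -/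
noncomputable def diagAct {M N : Type*} [AddCommGroup M] [Module k M] [Module H M]
    [IsScalarTower k H M] [AddCommGroup N] [Module k N] [Module H N] [IsScalarTower k H N]
    (h : H) : M ⊗[k] N →ₗ[k] M ⊗[k] N :=
  outerAct (Δ₂ k H h)

/-- The Fourier transform `F(f ⊗ g) = (f ⊗ 1) (S ⊗ id)Δ(g) = f S(g₍₁₎) ⊗ g₍₂₎`. -/
noncomputable def fourierAux : H ⊗[k] H →ₗ[k] H ⊗[k] H :=
  TensorProduct.lift ((LinearMap.mul k (H ⊗[k] H)).compl₁₂
    ((TensorProduct.mk k H H).flip 1)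
    ((HopfAlgebra.antipode k (A := H)).rTensor H ∘ₗ Coalgebra.comul))

theorem fourierAux_tmul (f g : H) : fourierAux (k := k) (f ⊗ₜ[k] g) =
    (f ⊗ₜ[k] (1 : H)) * (HopfAlgebra.antipode k (A := H)).rTensor H (Coalgebra.comul g) := rfl

theorem fourierAux_comul (h : H) : fourierAux (Δ₂ k H h) = (1 : H) ⊗ₜ[k] h := by
  have h1 : (fourierAux : H ⊗[k] H →ₗ[k] H ⊗[k] H) =
      (LinearMap.mul' k H ∘ₗ (HopfAlgebra.antipode k (A := H)).lTensor H).rTensor H ∘ₗ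
      (TensorProduct.assoc k H H H).symm.toLinearMap ∘ₗ
      (Coalgebra.comul (R := k) (A := H)).lTensor H := by
    refine TensorProduct.ext' fun u v => ?_
    rw [fourierAux_tmul]
    simp only [LinearMap.comp_apply, LinearMap.lTensor_tmul, LinearEquiv.coe_coe]
    generalize (Coalgebra.comul v : H ⊗[k] H) = w
    induction w using TensorProduct.induction_on with
    | zero => simp only [map_zero, mul_zero, TensorProduct.tmul_zero]
    | add x y hx hy => simp only [map_add, mul_add, TensorProduct.tmul_add, hx, hy]
    | tmul c d => simp
  rw [h1]
  simp only [LinearMap.comp_apply, LinearEquiv.coe_coe, Bialgebra.comulAlgHom_apply,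
    Coalgebra.coassoc_symm_apply]
  rw [← LinearMap.comp_apply, ← LinearMap.rTensor_comp, LinearMap.comp_assoc,
    HopfAlgebra.mul_antipode_lTensor_comul, LinearMap.rTensor_comp, LinearMap.comp_apply,
    Coalgebra.rTensor_counit_comul, LinearMap.rTensor_tmul]
  simp

theorem fourierAux_mul (ξ : H ⊗[k] H) (h : H) :
    fourierAux (ξ * Δ₂ k H h) = fourierAux ξ * ((1 : H) ⊗ₜ[k] h) := by
  induction ξ using TensorProduct.induction_on with
  | zero => simp only [zero_mul, map_zero]
  | add x y hx hy => simp only [add_mul, map_add, hx, hy]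
  | tmul f g =>
    let T : H ⊗[k] H →ₗ[k] H ⊗[k] H →ₗ[k] H ⊗[k] H :=
      TensorProduct.lift (LinearMap.mk₂ k
        (fun p q => TensorProduct.map
          (LinearMap.mulLeft k f ∘ₗ LinearMap.mulRight k (HopfAlgebra.antipode k p))
          (LinearMap.mulLeft k q))
        (fun p p' q => by ext; simp [mul_add, TensorProduct.add_tmul])
        (fun c p q => by ext; simp [TensorProduct.smul_tmul'])
        (fun p q q' => by ext; simp [add_mul, TensorProduct.tmul_add])
        (fun c p q => by ext; simp))
    have aux : ∀ w z : H ⊗[k] H, (TensorProduct.lift ((LinearMap.mul k (H ⊗[k] H)).compl₁₂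
        ((TensorProduct.mk k H H).flip 1 ∘ₗ LinearMap.mulLeft k f)
        ((HopfAlgebra.antipode k (A := H)).rTensor H ∘ₗ
          LinearMap.mulLeft k w ∘ₗ Coalgebra.comul))) z = T w (fourierAux z) := by
      intro w z
      induction z using TensorProduct.induction_on with
      | zero => simp only [map_zero]
      | add x y hx hy => simp only [map_add, hx, hy]
      | tmul u v =>
        rw [fourierAux_tmul, TensorProduct.lift.tmul]
        simp only [LinearMap.compl₁₂_apply, LinearMap.comp_apply, LinearMap.mul_apply',
          LinearMap.flip_apply, TensorProduct.mk_apply, LinearMap.mulLeft_apply]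
        generalize (Coalgebra.comul v : H ⊗[k] H) = y
        induction w using TensorProduct.induction_on with
        | zero => simp only [zero_mul, map_zero, mul_zero, LinearMap.zero_apply]
        | add w w' hw hw' => simp only [add_mul, map_add, mul_add, LinearMap.add_apply, hw, hw']
        | tmul p q =>
          induction y using TensorProduct.induction_on with
          | zero => simp only [map_zero, mul_zero]
          | add y y' hy hy' => simp only [map_add, mul_add, hy, hy']
          | tmul c d =>
            simp [T, HopfAlgebra.antipode_mul_antidistrib, mul_assoc]
    have h2 : ∀ z : H ⊗[k] H, fourierAux ((f ⊗ₜ[k] g) * z) =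
        T (Coalgebra.comul g) (fourierAux z) := by
      intro z
      rw [← aux]
      induction z using TensorProduct.induction_on with
      | zero => simp only [mul_zero, map_zero]
      | add x y hx hy => simp only [mul_add, map_add, hx, hy]
      | tmul u v =>
        rw [Algebra.TensorProduct.tmul_mul_tmul, fourierAux_tmul, Bialgebra.comul_mul]
        rfl
    rw [h2, fourierAux_comul, fourierAux_tmul]
    generalize (Coalgebra.comul g : H ⊗[k] H) = w
    induction w using TensorProduct.induction_on with
    | zero => simp only [map_zero, LinearMap.zero_apply, mul_zero, zero_mul]
    | add x y hx hy => simp only [map_add, LinearMap.add_apply, mul_add, add_mul, hx, hy]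
    | tmul p q => simp [T]

end Hopf

section Pseudo

variable {k : Type*} {H : Type v} [Field k] [Ring H] [HopfAlgebra k H]

/-! ### Pseudoalgebras -/

/-- `H^{⊗2} ⊗_H M`. -/
abbrev P₂ (k H : Type*) [Field k] [Ring H] [HopfAlgebra k H] (M : Type*) [AddCommGroup M]
    [Module k M] [Module H M] : Type _ := RelTensor (Δ₂ k H) M

/-- `H^{⊗3} ⊗_H M`. -/
abbrev P₃ (k H : Type*) [Field k] [Ring H] [HopfAlgebra k H] (M : Type*) [AddCommGroup M]
    [Module k M] [Module H M] : Type _ := RelTensor (Δ₃ k H) M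

/-- The element `(f ⊗ g) ⊗_H m` of `H^{⊗2} ⊗_H M`. -/
noncomputable def ptmul {M : Type*} [AddCommGroup M] [Module k M] [Module H M] (f g : H) (m : M) :
    P₂ k H M := RelTensor.tmul (Δ₂ k H) (f ⊗ₜ[k] g) m

variable (M : Type*) [AddCommGroup M] [Module k M] [Module H M]

/-- `σ ⊗_H id` on `H^{⊗2} ⊗_H M`, with `σ(f ⊗ g) = g ⊗ f`. -/
noncomputable def swap₂ [Coalgebra.IsCocomm k H] : P₂ k H M →ₗ[k] P₂ k H M :=
  RelTensor.map (Algebra.TensorProduct.comm k H H).toAlgHom (comm_comul k) M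

/-- `(σ ⊗ id) ⊗_H id` on `H^{⊗3} ⊗_H M`. -/
noncomputable def swap₃ [Coalgebra.IsCocomm k H] : P₃ k H M →ₗ[k] P₃ k H M :=
  RelTensor.map (Algebra.TensorProduct.leftComm k H H H).toAlgHom (leftComm_comul k) M

/-- `(f ⊗ g) ⊗_H m ↦ (f ⊗ g₍₁₎ ⊗ g₍₂₎) ⊗_H m`. -/
noncomputable def expandRight : P₂ k H M →ₗ[k] P₃ k H M :=
  RelTensor.map (idΔ k H) (idΔ_comul k) M

/-- `(f ⊗ g) ⊗_H m ↦ (f₍₁₎ ⊗ f₍₂₎ ⊗ g) ⊗_H m`. -/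
noncomputable def expandLeft : P₂ k H M →ₗ[k] P₃ k H M :=
  RelTensor.map (Δid k H) (Δid_comul k) M

variable {M}

/-- The Fourier transform `H^{⊗2} ⊗_H M → H ⊗ M`,
`(f ⊗ g) ⊗_H m ↦ f S(g₍₁₎) ⊗ g₍₂₎ m`. -/
noncomputable def pFourier [IsScalarTower k H M] : P₂ k H M →ₗ[k] H ⊗[k] M :=
  RelTensor.lift
    ((TensorProduct.lift (Algebra.lsmul k k M).toLinearMap).lTensor H ∘ₗ
      (TensorProduct.assoc k H H M).toLinearMap ∘ₗ fourierAux.rTensor M) <| by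
    intro ξ h m
    simp only [LinearMap.comp_apply, LinearMap.rTensor_tmul, fourierAux_mul]
    generalize fourierAux (k := k) ξ = z
    induction z using TensorProduct.induction_on with
    | zero => simp only [zero_mul, TensorProduct.zero_tmul, map_zero]
    | add x y hx hy => simp only [add_mul, TensorProduct.add_tmul, map_add, hx, hy]
    | tmul f g => simp

/-- For `x ∈ X`, the map `H^{⊗2} ⊗_H M → M`,
`(f ⊗ g) ⊗_H m ↦ ⟨S(x), f S(g₍₁₎)⟩ g₍₂₎ m`. -/
noncomputable def pFourierCoeff [IsScalarTower k H M] (x : X k H) : P₂ k H M →ₗ[k] M :=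
  (TensorProduct.lid k M).toLinearMap ∘ₗ (X.antip x).rTensor M ∘ₗ pFourier

/-- An `H`-bilinear pseudoproduct `a ⊗ b ↦ a * b ∈ H^{⊗2} ⊗_H L` on an `H`-module `L`. -/
structure Pseudoproduct (k H : Type*) [Field k] [Ring H] [HopfAlgebra k H] (L : Type*)
    [AddCommGroup L] [Module k L] [Module H L] where
  /-- the value `a * b` -/
  prod : L →ₗ[k] L →ₗ[k] P₂ k H L
  bilin : ∀ (f g : H) (a b : L), prod (f • a) (g • b) = (f ⊗ₜ[k] g) • prod a b

namespace Pseudoproduct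

variable {L : Type*} [AddCommGroup L] [Module k L] [Module H L]

theorem bilin_right (μ : Pseudoproduct k H L) (g : H) (a b : L) :
    μ.prod a (g • b) = ((1 : H) ⊗ₜ[k] g) • μ.prod a b := by
  have := μ.bilin 1 g a b
  rwa [one_smul] at this

theorem bilin_left (μ : Pseudoproduct k H L) (f : H) (a b : L) :
    μ.prod (f • a) b = (f ⊗ₜ[k] (1 : H)) • μ.prod a b := by
  have := μ.bilin f 1 a b
  rwa [one_smul] at this

/-- For fixed `a`, the map `z ↦ a * z` from `H^{⊗2} ⊗_H L` to `H^{⊗3} ⊗_H L`: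
if `a * d = ∑ (f ⊗ g) ⊗_H e`, then
`(h ⊗ l) ⊗_H d ↦ ∑ (f ⊗ h g₍₁₎ ⊗ l g₍₂₎) ⊗_H e`. -/
noncomputable def compRight (μ : Pseudoproduct k H L) (a : L) : P₂ k H L →ₗ[k] P₃ k H L :=
  RelTensor.lift
    (TensorProduct.lift (LinearMap.mk₂ k
      (fun (ξ : H ⊗[k] H) (d : L) => ((1 : H) ⊗ₜ[k] ξ) • expandRight L (μ.prod a d))
      (fun ξ ξ' d => by rw [TensorProduct.tmul_add, add_smul])
      (fun c ξ d => by rw [TensorProduct.tmul_smul, smul_assoc])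
      (fun ξ d d' => by rw [map_add, map_add, smul_add])
      (fun c ξ d => by rw [map_smul, map_smul, smul_comm]))) <| by
    intro ξ h d
    simp only [TensorProduct.lift.tmul, LinearMap.mk₂_apply]
    rw [bilin_right, expandRight, RelTensor.map_smul', smul_smul]
    congr 1
    simp [idΔ]

/-- For fixed `c`, the map `z ↦ z * c` from `H^{⊗2} ⊗_H L` to `H^{⊗3} ⊗_H L`:
if `e * c = ∑ (f ⊗ g) ⊗_H d`, then
`(h ⊗ l) ⊗_H e ↦ ∑ (h f₍₁₎ ⊗ l f₍₂₎ ⊗ g) ⊗_H d`. -/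
noncomputable def compLeft (μ : Pseudoproduct k H L) (c : L) : P₂ k H L →ₗ[k] P₃ k H L :=
  RelTensor.lift
    (TensorProduct.lift (LinearMap.mk₂ k
      (fun (ξ : H ⊗[k] H) (e : L) =>
        (Algebra.TensorProduct.assoc k k k H H H (ξ ⊗ₜ[k] (1 : H))) •
          expandLeft L (μ.prod e c))
      (fun ξ ξ' d => by rw [TensorProduct.add_tmul, map_add, add_smul])
      (fun c ξ d => by rw [← TensorProduct.smul_tmul', map_smul, smul_assoc])
      (fun ξ d d' => by rw [map_add, LinearMap.add_apply, map_add, smul_add])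
      (fun c ξ d => by rw [map_smul, LinearMap.smul_apply, map_smul, smul_comm]))) <| by
    intro ξ h d
    simp only [TensorProduct.lift.tmul, LinearMap.mk₂_apply]
    rw [bilin_left, expandLeft, RelTensor.map_smul', smul_smul]
    congr 1
    have h1 : Δid k H (h ⊗ₜ[k] (1 : H)) =
        Algebra.TensorProduct.assoc k k k H H H ((Δ₂ k H h) ⊗ₜ[k] (1 : H)) := rfl
    rw [h1, ← map_mul, Algebra.TensorProduct.tmul_mul_tmul, mul_one]

/-- A Lie pseudoalgebra structure: a pseudoproduct (written `[a * b]`) that is skew-commutative and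
satisfies the Jacobi identity. -/
structure IsLie [Coalgebra.IsCocomm k H] (μ : Pseudoproduct k H L) : Prop where
  skew : ∀ a b, μ.prod b a = - swap₂ L (μ.prod a b)
  jacobi : ∀ a b c, μ.compRight a (μ.prod b c) - swap₃ L (μ.compRight b (μ.prod a c)) =
    μ.compLeft c (μ.prod a b)

/-- The `x`-bracket `[a_x b] = (⟨S(x), ·⟩ ⊗ id) [a, b]`, with `[a, b] ∈ H ⊗ L` the Fourier
transform of `[a * b]`. -/
noncomputable def xbracket [IsScalarTower k H L] (μ : Pseudoproduct k H L) (a : L) (x : X k H)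
    (b : L) : L :=
  pFourierCoeff x (μ.prod a b)

end Pseudoproduct

/-! ### Lie `H`-conformal algebras -/

/-- A Lie `H`-conformal algebra structure on the `H`-module `L`, given by the `x`-brackets
`[a_x b] = br a x b`. -/
structure IsLieConformal {L : Type*} [AddCommGroup L] [Module k L] [Module H L]
    (br : L →ₗ[k] X k H →ₗ[k] L →ₗ[k] L) : Prop where
  /-- `codim {x ∈ X | [a_x b] = 0} < ∞` -/
  locality : ∀ a b, Module.Finite k (X k H ⧸ LinearMap.ker ((br a).flip b))
  /-- `[(h a)_x b] = [a_{x h} b]` -/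
  sesqui_left : ∀ (h : H) (a : L) (x : X k H) (b : L), br (h • a) x b = br a (X.ract x h) b
  /-- `[a_x (h b)] = h₍₂₎ [a_{S(h₍₁₎) x} b]` -/
  sesqui_right : ∀ (h : H) (a : L) (x : X k H) (b : L) (n : ℕ) (u v : Fin n → H),
    Δ₂ k H h = ∑ i, u i ⊗ₜ[k] v i →
    br a x (h • b) = ∑ i, v i • br a (X.lact (HopfAlgebra.antipode k (u i)) x) b
  /-- `[a_x b] = - ∑_i ⟨x, S(h_i₍₁₎)⟩ S(h_i₍₂₎) [b_{x_i} a]` for dual bases `h_i`, `x_i` -/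
  skew : ∀ {ι : Type v} (e : Module.Basis ι k H) (a : L) (x : X k H) (b : L),
    IsFiniteSum (fun i =>
      ((TensorProduct.lid k H) (TensorProduct.map (X.antip x) (HopfAlgebra.antipode k)
        (Δ₂ k H (e i)))) • br b (e.coord i) a) (- br a x b)
  /-- `[a_x [b_y c]] - [b_y [a_x c]] = [[a_{x₍₂₎} b]_{y x₍₁₎} c]` -/
  jacobi : ∀ {ι : Type v} (e : Module.Basis ι k H) (a b c : L) (x y : X k H),
    IsSweedlerSum e x (fun x₁ x₂ => br (br a x₂ b) (X.mul y x₁) c)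
      (br a x (br b y c) - br b y (br a x c))

/-! ### Pseudolinear maps and the pseudo-dual -/

/-- The space of `H`-pseudolinear maps: `k`-linear maps `φ : V → H^{⊗2} ⊗_H W` with
`φ(h v) = ((1 ⊗ h) ⊗_H 1) φ(v)`. -/
def Chom (k H : Type*) [Field k] [Ring H] [HopfAlgebra k H] (V W : Type*)
    [AddCommGroup V] [Module k V] [Module H V] [AddCommGroup W] [Module k W] [Module H W] :
    Submodule k (V →ₗ[k] P₂ k H W) where
  carrier := {φ | ∀ (h : H) (v : V), φ (h • v) = ((1 : H) ⊗ₜ[k] h) • φ v}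
  add_mem' := by
    intro φ ψ hφ hψ h v
    rw [LinearMap.add_apply, LinearMap.add_apply, hφ, hψ, smul_add]
  zero_mem' := by
    intro h v
    rw [LinearMap.zero_apply, LinearMap.zero_apply, smul_zero]
  smul_mem' := by
    intro c φ hφ h v
    rw [LinearMap.smul_apply, LinearMap.smul_apply, hφ, smul_comm]

namespace Chom

variable {V W : Type*} [AddCommGroup V] [Module k V] [Module H V]
  [AddCommGroup W] [Module k W] [Module H W]

/-- The left action of `H` on `Chom(V, W)`: `(h φ)(v) = ((h ⊗ 1) ⊗_H 1) φ(v)`. -/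
noncomputable instance : SMul H (Chom k H V W) where
  smul h φ := ⟨(Algebra.lsmul k k (P₂ k H W) (h ⊗ₜ[k] (1 : H))) ∘ₗ φ.1, by
    intro g v
    simp only [LinearMap.comp_apply, Algebra.lsmul_coe]
    rw [φ.2 g v, smul_smul, smul_smul, Algebra.TensorProduct.tmul_mul_tmul,
      Algebra.TensorProduct.tmul_mul_tmul, mul_one, one_mul, mul_one, one_mul]⟩

theorem smul_apply (h : H) (φ : Chom k H V W) (v : V) :
    (h • φ).1 v = (h ⊗ₜ[k] (1 : H)) • φ.1 v := rfl

noncomputable instance : Module H (Chom k H V W) where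
  one_smul φ := by
    refine Subtype.ext (LinearMap.ext fun v => ?_)
    rw [smul_apply, ← Algebra.TensorProduct.one_def, one_smul]
  mul_smul g h φ := by
    refine Subtype.ext (LinearMap.ext fun v => ?_)
    rw [smul_apply, smul_apply, smul_apply, smul_smul, Algebra.TensorProduct.tmul_mul_tmul, mul_one]
  smul_zero h := by
    refine Subtype.ext (LinearMap.ext fun v => ?_)
    exact smul_zero (A := P₂ k H W) (h ⊗ₜ[k] (1 : H))
  smul_add h φ ψ := by
    refine Subtype.ext (LinearMap.ext fun v => ?_)
    exact smul_add (A := P₂ k H W) (h ⊗ₜ[k] (1 : H)) (φ.1 v) (ψ.1 v)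
  add_smul g h φ := by
    refine Subtype.ext (LinearMap.ext fun v => ?_)
    change _ = (g • φ).1 v + (h • φ).1 v
    rw [smul_apply, smul_apply, smul_apply, TensorProduct.add_tmul, add_smul]
  zero_smul φ := by
    refine Subtype.ext (LinearMap.ext fun v => ?_)
    rw [smul_apply, TensorProduct.zero_tmul, zero_smul]
    rfl

instance : IsScalarTower k H (Chom k H V W) where
  smul_assoc c h φ := by
    refine Subtype.ext (LinearMap.ext fun v => ?_)
    change _ = c • (h • φ).1 v
    rw [smul_apply, smul_apply, ← TensorProduct.smul_tmul', smul_assoc]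

end Chom

/-- The base field `k` as a trivial `H`-module: `h · c = ε(h) c`. -/
def Triv (k _H : Type*) : Type _ := k

noncomputable instance : AddCommGroup (Triv k H) := inferInstanceAs (AddCommGroup k)

noncomputable instance : Module k (Triv k H) := inferInstanceAs (Module k k)

noncomputable instance : Module H (Triv k H) :=
  Module.compHom k (Bialgebra.counitAlgHom k H).toRingHom

theorem Triv.smul_def (h : H) (c : Triv k H) :
    h • c = ((Coalgebra.counit h : k) • c : Triv k H) := rfl

instance : IsScalarTower k H (Triv k H) where
  smul_assoc c h t := by
    rw [Triv.smul_def, Triv.smul_def, map_smul, smul_assoc]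

/-- The element `c` of `k`, seen in the trivial module. -/
def Triv.of (k H : Type*) (c : k) : Triv k H := c

/-- An element of the trivial module, seen in `k`. -/
def Triv.val {k H : Type*} (c : Triv k H) : k := c

/-- The pseudo-dual `V^* = Chom(V, k)`. -/
abbrev PDual (k H : Type*) [Field k] [Ring H] [HopfAlgebra k H] (V : Type*)
    [AddCommGroup V] [Module k V] [Module H V] : Type _ := Chom k H V (Triv k H)

/-- The Fourier coefficients of `f ∈ V^*`:
`f_x v = ∑ ⟨S(x), g S(l₍₁₎)⟩ l₍₂₎ c ∈ k` if `f(v) = ∑ (g ⊗ l) ⊗_H c`. -/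
noncomputable def PDual.coeff {V : Type*} [AddCommGroup V] [Module k V] [Module H V]
    (f : PDual k H V) (x : X k H) (v : V) : k :=
  Triv.val (pFourierCoeff x (f.1 v))

/-! ### Lie `H`-coalgebras -/

/-- A Lie `H`-coalgebra structure on the `H`-module `R`: an `H`-linear map
`δ : R → ∧² R ⊆ R ⊗ R` (skew-symmetric tensors; the characteristic is `0`) satisfying the
co-Jacobi identity `(id ⊗ δ) δ - τ₁₂ (id ⊗ δ) δ = (δ ⊗ id) δ`. -/
structure IsLieCoalgebra {R : Type*} [AddCommGroup R] [Module k R] [Module H R]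
    [IsScalarTower k H R] (δ : R →ₗ[k] R ⊗[k] R) : Prop where
  map_act : ∀ (h : H) (r : R), δ (h • r) = diagAct h (δ r)
  skew : ∀ r, TensorProduct.comm k R R (δ r) = - δ r
  coJacobi : ∀ r, δ.lTensor R (δ r) - TensorProduct.leftComm k R R R (δ.lTensor R (δ r)) =
    TensorProduct.assoc k R R R (δ.rTensor R (δ r))

/-- `δ : L^* → L^* ⊗ L^*` is the `H`-linear extension of
`δ(a^p) = ∑_{i,j} S(h^{ij}_p) a^i ⊗ S(l^{ij}_p) a^j`, where `h^{ij}_p ⊗ l^{ij}_p` stands for the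
element `∑_q h i j p q ⊗ l i j p q` of `H ⊗ H`. -/
def IsDualCobracket {D : Type*} [AddCommGroup D] [Module k D] [Module H D] [IsScalarTower k H D]
    {N m : ℕ} (a' : Fin N → D) (h l : Fin N → Fin N → Fin N → Fin m → H)
    (δ : D →ₗ[k] D ⊗[k] D) : Prop :=
  (∀ (g : H) (φ : D), δ (g • φ) = diagAct g (δ φ)) ∧
  ∀ p, δ (a' p) = ∑ i, ∑ j, ∑ q,
    (HopfAlgebra.antipode k (h i j p q) • a' i) ⊗ₜ[k] (HopfAlgebra.antipode k (l i j p q) • a' j)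

/-- The `x`-brackets `br` on `R^*` are given by
`[f_x g]_y(r) = ∑ f_{x₍₂₎}(r₍₁₎) g_{y S(x₍₁₎)}(r₍₂₎)`, where `δ(r) = ∑ r₍₁₎ ⊗ r₍₂₎`. -/
def IsDualBracket {R : Type*} [AddCommGroup R] [Module k R] [Module H R]
    (δ : R →ₗ[k] R ⊗[k] R)
    (br : PDual k H R →ₗ[k] X k H →ₗ[k] PDual k H R →ₗ[k] PDual k H R) : Prop :=
  ∀ {ι : Type v} (e : Module.Basis ι k H) (f g : PDual k H R) (x y : X k H) (r : R)
    (n : ℕ) (u v : Fin n → R), δ r = ∑ s, u s ⊗ₜ[k] v s →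
    IsSweedlerSum e x
      (fun x₁ x₂ => ∑ s, f.coeff x₂ (u s) * g.coeff (X.mul y (X.antip x₁)) (v s))
      ((br f x g).coeff y r)

end Pseudo

end HPseudo

open HPseudo

/-! Everything becomes transposition once pseudo-objects are read as functions. The map (f ⊗ g) ⊗_H
c ↦ c f S(g) identifies H^{⊗2} ⊗_H k with H, so V^* is the space of k-linear F : V → H with F(hv) =
F(v) S(h), on which H acts by left multiplication (`PDual.fn`). Likewise an element of H^{⊗2} ⊗_H
V^* or H^{⊗3} ⊗_H V^* has a value at each v, through a ⊗_H φ ↦ a Δ(φ(v)) (`PDual.evAt`). The Fourier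
isomorphism (B ⊗ H) ⊗_H M ≅ B ⊗ M shows that these values determine the element
(`PDual.eq_of_evAt`). When V is finitely generated, every Θ : V → H ⊗ H with Θ(hv) = Θ(v) Δ(S(h)) is
the value function of some element (`PDual.exists_evAt_eq`).

For (b), [f * g] is the element with value (f ⊗ g)(δ(r)) at r. The required equivariance comes from
the H-linearity of δ and from ΔS = (S ⊗ S)Δ, a consequence of cocommutativity. Skew-commutativity
and the Jacobi identity are the coalgebra axioms with f ⊗ g and f ⊗ g ⊗ e applied to them
(`isLie_dualPseudoproduct`). The conformal axioms hold for the x-brackets of any Lie pseudoalgebra,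
by taking Fourier coefficients of its axioms (`Pseudoproduct.IsLie.isLieConformal`). Uniqueness
holds because Fourier coefficients separate the points of V^* and of H^{⊗2} ⊗_H M.

For (a), the argument is transposed. The pairing ⟨a ⊗_H m, φ⟩ = Δ(φ(m)) S(a) of A ⊗_H L with L^*
satisfies (ev_u ⊗ ev_v) δ(φ) = ⟨[u * v], φ⟩: on bases this is the formula for δ, and both sides are
equivariant in φ, u and v (`IsDualCobracket.isDualTo`). Evaluations are jointly injective on tensor
powers of L^*, since k is a field, so the Lie axioms for L give the coalgebra axioms for L^*. -/

namespace HPseudo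

/-! ### The antipode of a cocommutative Hopf algebra -/

section HopfLemmas

variable {k H : Type*} [Field k] [Ring H] [HopfAlgebra k H]

-- In the convolution algebra both id and S² are inverse to S. For S² one has S(a) S²(b) = S(S(b)
-- a), and cocommutativity allows a and b to be interchanged in Δ(h).
open HopfAlgebra in
theorem antipode_antipode_of_cocomm [Coalgebra.IsCocomm k H] (h : H) :
    antipode k (antipode k h) = h := by
  have h1 : WithConv.toConv (LinearMap.id : H →ₗ[k] H) =
      WithConv.toConv (antipode k ∘ₗ antipode k) := by
    apply left_inv_eq_right_inv (a := WithConv.toConv (antipode k (A := H)))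
    · exact LinearMap.id_mul_antipode
    · apply WithConv.ext
      ext c
      simp only [LinearMap.convMul_def, LinearMap.convOne_def, WithConv.ofConv_toConv,
        LinearMap.comp_apply]
      have h2 : ∀ z : H ⊗[k] H, LinearMap.mul' k H
          (TensorProduct.map (antipode k) (antipode k ∘ₗ antipode k) z) =
          antipode k (LinearMap.mul' k H ((antipode k).rTensor H
            (TensorProduct.comm k H H z))) := by
        intro z
        induction z using TensorProduct.induction_on with
        | zero => simp only [map_zero]
        | add x y hx hy => simp only [map_add, hx, hy]
        | tmul a b => simp [antipode_mul_antidistrib]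
      rw [h2, Coalgebra.comm_comul, mul_antipode_rTensor_comul_apply]
      simp [Algebra.algebraMap_eq_smul_one]
  exact (LinearMap.congr_fun (congrArg WithConv.ofConv h1) h).symm

variable (k H) in
/-- The map `S ⊗ S` on `H ⊗ H`. -/
noncomputable def antipode₂ : H ⊗[k] H →ₗ[k] H ⊗[k] H :=
  TensorProduct.map (HopfAlgebra.antipode k) (HopfAlgebra.antipode k)

variable (k H) in
/-- The map `S ⊗ S ⊗ S` on `H ⊗ H ⊗ H`. -/
noncomputable def antipode₃ : H ⊗[k] (H ⊗[k] H) →ₗ[k] H ⊗[k] (H ⊗[k] H) :=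
  TensorProduct.map (HopfAlgebra.antipode k) (antipode₂ k H)

@[simp] theorem antipode₂_tmul (f g : H) : antipode₂ k H (f ⊗ₜ g) =
    HopfAlgebra.antipode k f ⊗ₜ HopfAlgebra.antipode k g := rfl

@[simp] theorem antipode₃_tmul (f : H) (z : H ⊗[k] H) : antipode₃ k H (f ⊗ₜ z) =
    HopfAlgebra.antipode k f ⊗ₜ antipode₂ k H z := rfl

theorem map_antidistrib {A B : Type*} [Ring A] [Algebra k A] [Ring B] [Algebra k B]
    (S : A →ₗ[k] A) (T : B →ₗ[k] B) (hS : ∀ a b, S (a * b) = S b * S a)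
    (hT : ∀ a b, T (a * b) = T b * T a) (w z : A ⊗[k] B) :
    TensorProduct.map S T (w * z) = TensorProduct.map S T z * TensorProduct.map S T w := by
  induction w using TensorProduct.induction_on with
  | zero => simp only [zero_mul, mul_zero, map_zero]
  | add x y hx hy => simp only [add_mul, mul_add, map_add, hx, hy]
  | tmul a b =>
    induction z using TensorProduct.induction_on with
    | zero => simp only [zero_mul, mul_zero, map_zero]
    | add x y hx hy => simp only [add_mul, mul_add, map_add, hx, hy]
    | tmul c d => simp [hS, hT]

theorem antipode₂_mul (w z : H ⊗[k] H) :
    antipode₂ k H (w * z) = antipode₂ k H z * antipode₂ k H w :=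
  map_antidistrib _ _ HopfAlgebra.antipode_mul_antidistrib HopfAlgebra.antipode_mul_antidistrib _ _

theorem antipode₃_mul (w z : H ⊗[k] (H ⊗[k] H)) :
    antipode₃ k H (w * z) = antipode₃ k H z * antipode₃ k H w :=
  map_antidistrib _ _ HopfAlgebra.antipode_mul_antidistrib antipode₂_mul _ _

-- Both sides are convolution inverses of Δ : H → H ⊗ H. For (S ⊗ S)Δ this is the antipode axiom of
-- H ⊗ H pulled back along Δ, which is a coalgebra map because H is cocommutative.
open HopfAlgebra in
theorem comul_antipode [Coalgebra.IsCocomm k H] (h : H) :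
    Δ₂ k H (antipode k h) = antipode₂ k H (Δ₂ k H h) := by
  have h1 : WithConv.toConv (antipode₂ k H ∘ₗ Coalgebra.comul) =
      WithConv.toConv (Coalgebra.comul ∘ₗ antipode k (A := H)) := by
    apply left_inv_eq_right_inv (a := WithConv.toConv (Coalgebra.comul (R := k) (A := H)))
    · have h2 := LinearMap.convMul_comp_coalgHom_distrib
        (WithConv.toConv (antipode k (A := H ⊗[k] H))) (WithConv.toConv LinearMap.id)
        (Coalgebra.comulCoalgHom k H)
      rw [LinearMap.antipode_mul_id] at h2
      apply WithConv.ext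
      refine Eq.trans h2.symm ?_
      ext c
      exact congrArg (algebraMap k (H ⊗[k] H))
        (CoalgHomClass.counit_comp_apply (Coalgebra.comulCoalgHom k H) c)
    · exact LinearMap.comul_right_inv
  exact (LinearMap.congr_fun (congrArg WithConv.ofConv h1) h).symm

theorem idΔ_antipode₂ [Coalgebra.IsCocomm k H] (z : H ⊗[k] H) :
    idΔ k H (antipode₂ k H z) = antipode₃ k H (idΔ k H z) := by
  induction z using TensorProduct.induction_on with
  | zero => simp only [map_zero]
  | add x y hx hy => simp only [map_add, hx, hy]
  | tmul a b =>
    exact congrArg (fun w => HopfAlgebra.antipode k a ⊗ₜ[k] w) (comul_antipode b)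

theorem antipode₃_assoc (w : H ⊗[k] H) (b : H) :
    antipode₃ k H (Algebra.TensorProduct.assoc k k k H H H (w ⊗ₜ b)) =
      Algebra.TensorProduct.assoc k k k H H H
        (antipode₂ k H w ⊗ₜ HopfAlgebra.antipode k b) := by
  induction w using TensorProduct.induction_on with
  | zero => simp only [TensorProduct.zero_tmul, map_zero]
  | add x y hx hy => simp only [TensorProduct.add_tmul, map_add, hx, hy]
  | tmul a b => rfl

theorem Δid_antipode₂ [Coalgebra.IsCocomm k H] (z : H ⊗[k] H) :
    Δid k H (antipode₂ k H z) = antipode₃ k H (Δid k H z) := by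
  induction z using TensorProduct.induction_on with
  | zero => simp only [map_zero]
  | add x y hx hy => simp only [map_add, hx, hy]
  | tmul a b =>
    refine Eq.trans ?_ (antipode₃_assoc (Δ₂ k H a) b).symm
    rw [← comul_antipode]
    rfl

theorem Δ₃_antipode [Coalgebra.IsCocomm k H] (h : H) :
    Δ₃ k H (HopfAlgebra.antipode k h) = antipode₃ k H (Δ₃ k H h) := by
  rw [← idΔ_comul, comul_antipode, idΔ_antipode₂, idΔ_comul]

theorem antipode₃_leftComm (z : H ⊗[k] (H ⊗[k] H)) :
    antipode₃ k H (Algebra.TensorProduct.leftComm k H H H z) =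
      Algebra.TensorProduct.leftComm k H H H (antipode₃ k H z) := by
  have : antipode₃ k H ∘ₗ (Algebra.TensorProduct.leftComm k H H H).toLinearMap =
      (Algebra.TensorProduct.leftComm k H H H).toLinearMap ∘ₗ antipode₃ k H := by
    ext a b c
    rfl
  exact LinearMap.congr_fun this z

theorem antipode₂_comm (z : H ⊗[k] H) :
    antipode₂ k H (Algebra.TensorProduct.comm k H H z) =
      Algebra.TensorProduct.comm k H H (antipode₂ k H z) := by
  have : antipode₂ k H ∘ₗ (Algebra.TensorProduct.comm k H H).toLinearMap =
      (Algebra.TensorProduct.comm k H H).toLinearMap ∘ₗ antipode₂ k H := by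
    ext a b
    rfl
  exact LinearMap.congr_fun this z

end HopfLemmas

/-! ### The twisting isomorphism of B ⊗ H -/

section Untwist

variable {k H B : Type*} [Field k] [Ring H] [HopfAlgebra k H] [Ring B] [Algebra k B]

/-- The map `b ⊗ h ↦ b α(h₍₁₎) ⊗ h₍₂₎`. -/
noncomputable def twist (α : H →ₐ[k] B) : B ⊗[k] H →ₗ[k] B ⊗[k] H :=
  TensorProduct.lift ((LinearMap.mul k (B ⊗[k] H)).compl₁₂ ((TensorProduct.mk k B H).flip 1)
    (α.toLinearMap.rTensor H ∘ₗ Coalgebra.comul))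

/-- The map `b ⊗ h ↦ b α(S(h₍₁₎)) ⊗ h₍₂₎`, inverse to `twist α`. -/
noncomputable def untwist (α : H →ₐ[k] B) : B ⊗[k] H →ₗ[k] B ⊗[k] H :=
  TensorProduct.lift ((LinearMap.mul k (B ⊗[k] H)).compl₁₂ ((TensorProduct.mk k B H).flip 1)
    ((α.toLinearMap ∘ₗ HopfAlgebra.antipode k).rTensor H ∘ₗ Coalgebra.comul))

variable (α : H →ₐ[k] B)

theorem twist_tmul (b : B) (h : H) : twist α (b ⊗ₜ h) =
    (b ⊗ₜ[k] (1 : H)) * α.toLinearMap.rTensor H (Coalgebra.comul h) := rfl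

theorem untwist_tmul (b : B) (h : H) : untwist α (b ⊗ₜ h) =
    (b ⊗ₜ[k] (1 : H)) *
      (α.toLinearMap ∘ₗ HopfAlgebra.antipode k).rTensor H (Coalgebra.comul h) := rfl

theorem untwist_id : untwist (AlgHom.id k H) = fourierAux := rfl

theorem twist_mul_left (b : B) (z : B ⊗[k] H) :
    twist α ((b ⊗ₜ 1) * z) = (b ⊗ₜ 1) * twist α z := by
  induction z using TensorProduct.induction_on with
  | zero => simp only [mul_zero, map_zero]
  | add x y hx hy => simp only [mul_add, map_add, hx, hy]
  | tmul c d =>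
    rw [Algebra.TensorProduct.tmul_mul_tmul, twist_tmul, twist_tmul, ← mul_assoc,
      Algebra.TensorProduct.tmul_mul_tmul, one_mul, one_mul]

theorem untwist_mul_left (b : B) (z : B ⊗[k] H) :
    untwist α ((b ⊗ₜ 1) * z) = (b ⊗ₜ 1) * untwist α z := by
  induction z using TensorProduct.induction_on with
  | zero => simp only [mul_zero, map_zero]
  | add x y hx hy => simp only [mul_add, map_add, hx, hy]
  | tmul c d =>
    rw [Algebra.TensorProduct.tmul_mul_tmul, untwist_tmul, untwist_tmul, ← mul_assoc,
      Algebra.TensorProduct.tmul_mul_tmul, one_mul, one_mul]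

theorem twist_rTensor (z : H ⊗[k] H) : twist α (α.toLinearMap.rTensor H z) =
    α.toLinearMap.rTensor H (twist (AlgHom.id k H) z) := by
  induction z using TensorProduct.induction_on with
  | zero => simp only [map_zero]
  | add x y hx hy => simp only [map_add, hx, hy]
  | tmul c d =>
    rw [LinearMap.rTensor_tmul, twist_tmul, twist_tmul]
    generalize (Coalgebra.comul d : H ⊗[k] H) = w
    induction w using TensorProduct.induction_on with
    | zero => simp only [map_zero, mul_zero]
    | add x y hx hy => simp only [map_add, mul_add, hx, hy]
    | tmul p q => simp

theorem untwist_rTensor (z : H ⊗[k] H) : untwist α (α.toLinearMap.rTensor H z) =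
    α.toLinearMap.rTensor H (untwist (AlgHom.id k H) z) := by
  induction z using TensorProduct.induction_on with
  | zero => simp only [map_zero]
  | add x y hx hy => simp only [map_add, hx, hy]
  | tmul c d =>
    rw [LinearMap.rTensor_tmul, untwist_tmul, untwist_tmul]
    generalize (Coalgebra.comul d : H ⊗[k] H) = w
    induction w using TensorProduct.induction_on with
    | zero => simp only [map_zero, mul_zero]
    | add x y hx hy => simp only [map_add, mul_add, hx, hy]
    | tmul p q => simp

/-- By coassociativity the left side is S(h₍₁₎) h₍₂₎ ⊗ h₍₃₎, which collapses by the antipode axiom.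
Together with `fourierAux_comul`, which is the opposite composite, this is the Hopf input for
general α and b: twisting commutes with left multiplication by B and is natural in α. -/
theorem twist_untwist_id_one_tmul (h : H) :
    twist (AlgHom.id k H) (untwist (AlgHom.id k H) ((1 : H) ⊗ₜ h)) = (1 : H) ⊗ₜ[k] h := by
  have h1 : ∀ w : H ⊗[k] H,
      twist (AlgHom.id k H) ((HopfAlgebra.antipode k (A := H)).rTensor H w) =
      (LinearMap.mul' k H ∘ₗ (HopfAlgebra.antipode k (A := H)).rTensor H).rTensor H
      ((TensorProduct.assoc k H H H).symm
      ((Coalgebra.comul (R := k) (A := H)).lTensor H w)) := by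
    intro w
    induction w using TensorProduct.induction_on with
    | zero => simp only [map_zero]
    | add x y hx hy => simp only [map_add, hx, hy]
    | tmul u v =>
      rw [LinearMap.rTensor_tmul, LinearMap.lTensor_tmul, twist_tmul]
      generalize (Coalgebra.comul v : H ⊗[k] H) = w
      induction w using TensorProduct.induction_on with
      | zero => simp only [map_zero, mul_zero, TensorProduct.tmul_zero]
      | add x y hx hy => simp only [map_add, mul_add, TensorProduct.tmul_add, hx, hy]
      | tmul c d => simp
  rw [untwist_tmul, ← Algebra.TensorProduct.one_def, one_mul]
  refine (h1 _).trans ?_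
  rw [Coalgebra.coassoc_symm_apply, ← LinearMap.comp_apply, ← LinearMap.rTensor_comp,
    LinearMap.comp_assoc, HopfAlgebra.mul_antipode_rTensor_comul, LinearMap.rTensor_comp,
    LinearMap.comp_apply, Coalgebra.rTensor_counit_comul, LinearMap.rTensor_tmul]
  simp

theorem untwist_twist (z : B ⊗[k] H) : untwist α (twist α z) = z := by
  induction z using TensorProduct.induction_on with
  | zero => simp only [map_zero]
  | add x y hx hy => simp only [map_add, hx, hy]
  | tmul b h =>
    rw [twist_tmul, untwist_mul_left, untwist_rTensor, untwist_id]
    have := fourierAux_comul (k := k) h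
    rw [Bialgebra.comulAlgHom_apply] at this
    rw [this]
    simp

theorem twist_untwist (z : B ⊗[k] H) : twist α (untwist α z) = z := by
  induction z using TensorProduct.induction_on with
  | zero => simp only [map_zero]
  | add x y hx hy => simp only [map_add, hx, hy]
  | tmul b h =>
    have h1 := twist_untwist_id_one_tmul (k := k) h
    rw [untwist_tmul, ← Algebra.TensorProduct.one_def, one_mul] at h1
    rw [untwist_tmul, twist_mul_left, LinearMap.rTensor_comp, LinearMap.comp_apply, twist_rTensor]
    have h2 : twist (AlgHom.id k H) ((HopfAlgebra.antipode k (A := H)).rTensor H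
      (Coalgebra.comul h)) = (1 : H) ⊗ₜ[k] h := h1
    rw [h2]
    simp

theorem twist_mul_right (z : B ⊗[k] H) (h : H) :
    twist α (z * ((1 : B) ⊗ₜ h)) = twist α z * Algebra.TensorProduct.map α (AlgHom.id k H)
      (Δ₂ k H h) := by
  have h1 : ∀ w : H ⊗[k] H, α.toLinearMap.rTensor H w =
    Algebra.TensorProduct.map α (AlgHom.id k H) w := fun _ => rfl
  induction z using TensorProduct.induction_on with
  | zero => simp only [zero_mul, map_zero]
  | add x y hx hy => simp only [add_mul, map_add, hx, hy]
  | tmul b g =>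
    rw [Algebra.TensorProduct.tmul_mul_tmul, mul_one, twist_tmul, twist_tmul, Bialgebra.comul_mul,
      h1, h1, map_mul, mul_assoc]
    rfl

/-- Obtained by inverting `twist_mul_right`, where only multiplicativity of Δ is used. It is what
makes the Fourier transform balanced over H. -/
theorem untwist_mul_right (z : B ⊗[k] H) (h : H) :
    untwist α (z * Algebra.TensorProduct.map α (AlgHom.id k H) (Δ₂ k H h)) =
      untwist α z * ((1 : B) ⊗ₜ h) := by
  rw [← untwist_twist α (untwist α z * _), twist_mul_right, twist_untwist]

end Untwist

/-! ### The Fourier isomorphism (B ⊗ H) ⊗_H M ≅ B ⊗ M -/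

section Fourier

variable {k H B : Type*} [Field k] [Ring H] [HopfAlgebra k H] [Ring B] [Algebra k B]
  {M : Type*} [AddCommGroup M] [Module k M] [Module H M]

/-- The element `∑ (b ⊗ 1) ⊗_H m` of `(B ⊗ H) ⊗_H M` attached to `∑ b ⊗ m`. -/
noncomputable def invFourier (Δ : H →ₐ[k] B ⊗[k] H) : B ⊗[k] M →ₗ[k] RelTensor Δ M :=
  RelTensor.proj Δ M ∘ₗ ((TensorProduct.mk k B H).flip 1).rTensor M

theorem invFourier_tmul (Δ : H →ₐ[k] B ⊗[k] H) (b : B) (m : M) :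
    invFourier Δ (b ⊗ₜ m) = RelTensor.tmul Δ (b ⊗ₜ 1) m := rfl

variable [IsScalarTower k H M] {Δ : H →ₐ[k] B ⊗[k] H} (α : H →ₐ[k] B)
  (hΔ : ∀ h, Δ h = Algebra.TensorProduct.map α (AlgHom.id k H) (Δ₂ k H h))

/-- The Fourier transform `(B ⊗ H) ⊗_H M → B ⊗ M`, `(b ⊗ g) ⊗_H m ↦ b α(S(g₍₁₎)) ⊗ g₍₂₎ m`,
where `H` acts on `B ⊗ H` through `(α ⊗ id) Δ`. -/
noncomputable def fourier : RelTensor Δ M →ₗ[k] B ⊗[k] M :=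
  RelTensor.lift
    ((TensorProduct.lift (Algebra.lsmul k k M).toLinearMap).lTensor B ∘ₗ
      (TensorProduct.assoc k B H M).toLinearMap ∘ₗ (untwist α).rTensor M) <| by
    intro ξ h m
    simp only [LinearMap.comp_apply, LinearMap.rTensor_tmul, hΔ, untwist_mul_right]
    generalize untwist α ξ = z
    induction z using TensorProduct.induction_on with
    | zero => simp only [zero_mul, TensorProduct.zero_tmul, map_zero]
    | add x y hx hy => simp only [add_mul, TensorProduct.add_tmul, map_add, hx, hy]
    | tmul f g => simp

theorem fourier_tmul_twist (b : B) (h : H) (m : M) :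
    fourier α hΔ (RelTensor.tmul Δ (twist α (b ⊗ₜ h)) m) = b ⊗ₜ (h • m) := by
  simp [fourier, untwist_twist]

@[simp] theorem fourier_invFourier (t : B ⊗[k] M) : fourier α hΔ (invFourier Δ t) = t := by
  induction t using TensorProduct.induction_on with
  | zero => simp only [map_zero]
  | add x y hx hy => simp only [map_add, hx, hy]
  | tmul b m =>
    have h1 : b ⊗ₜ[k] (1 : H) = twist α (b ⊗ₜ 1) := by
      rw [twist_tmul, Bialgebra.comul_one, Algebra.TensorProduct.one_def]
      simp
    rw [invFourier_tmul, h1, fourier_tmul_twist, one_smul]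

@[simp] theorem invFourier_fourier (z : RelTensor Δ M) :
    invFourier Δ (fourier α hΔ z) = z := by
  induction z using RelTensor.induction with
  | h0 => simp only [map_zero]
  | ha x y hx hy => simp only [map_add, hx, hy]
  | ht a m =>
    -- This writes a as a combination of elements (b ⊗ 1) Δ(h), whose factor Δ(h) moves across ⊗_H.
    rw [← twist_untwist α a]
    generalize untwist α a = w
    induction w using TensorProduct.induction_on with
    | zero => simp only [map_zero, RelTensor.tmul, TensorProduct.zero_tmul]
    | add x y hx hy =>
      simp only [map_add, RelTensor.tmul, TensorProduct.add_tmul] at hx hy ⊢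
      rw [hx, hy]
    | tmul b h =>
      rw [fourier_tmul_twist, invFourier_tmul, ← RelTensor.tmul_balanced, hΔ, twist_tmul]
      rfl

-- Surjectivity of `invFourier`: the elements (b ⊗ 1) ⊗_H m span. On them no antipode or Sweedler
-- index survives, so linear identities about Fourier coefficients can be checked there without
-- expanding coproducts.
include α hΔ in
theorem RelTensor.induction_tmul_one {p : RelTensor Δ M → Prop} (h0 : p 0)
    (ht : ∀ b m, p (RelTensor.tmul Δ (b ⊗ₜ 1) m))
    (ha : ∀ x y, p x → p y → p (x + y)) (z : RelTensor Δ M) : p z := by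
  rw [← invFourier_fourier α hΔ z]
  generalize fourier α hΔ z = t
  induction t using TensorProduct.induction_on with
  | zero => rw [map_zero]; exact h0
  | add x y hx hy => rw [map_add]; exact ha _ _ hx hy
  | tmul b m => exact ht b m

end Fourier

/-! ### Fourier coefficients in H^{⊗2} ⊗_H M and H^{⊗3} ⊗_H M -/

section FourierTwo

variable {k H : Type*} [Field k] [Ring H] [HopfAlgebra k H]
  {M : Type*} [AddCommGroup M] [Module k M] [Module H M] [IsScalarTower k H M]

theorem Δ₂_eq_map_id (h : H) :
    Δ₂ k H h = Algebra.TensorProduct.map (AlgHom.id k H) (AlgHom.id k H) (Δ₂ k H h) := by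
  rw [Algebra.TensorProduct.map_id, AlgHom.id_apply]

@[simp] theorem pFourier_ptmul_one (f : H) (m : M) :
    pFourier (ptmul f 1 m : P₂ k H M) = f ⊗ₜ[k] m :=
  fourier_invFourier (Δ := Δ₂ k H) (AlgHom.id k H) Δ₂_eq_map_id (f ⊗ₜ[k] m)

theorem pFourier_injective : Function.Injective (pFourier (k := k) (H := H) (M := M)) :=
  Function.LeftInverse.injective
    (g := invFourier (Δ₂ k H)) (invFourier_fourier (AlgHom.id k H) Δ₂_eq_map_id)

theorem P₂.induction {p : P₂ k H M → Prop} (h0 : p 0) (ht : ∀ f m, p (ptmul f 1 m))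
    (ha : ∀ x y, p x → p y → p (x + y)) (z : P₂ k H M) : p z :=
  RelTensor.induction_tmul_one (AlgHom.id k H) Δ₂_eq_map_id h0 ht ha z

omit [IsScalarTower k H M] in
theorem ptmul_add_left (f f' g : H) (m : M) :
    (ptmul (f + f') g m : P₂ k H M) = ptmul f g m + ptmul f' g m := by
  simp only [ptmul, RelTensor.tmul, TensorProduct.add_tmul, map_add]

omit [IsScalarTower k H M] in
theorem smul_ptmul (f g f' g' : H) (m : M) :
    (f ⊗ₜ[k] g) • (ptmul f' g' m : P₂ k H M) = ptmul (f * f') (g * g') m := by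
  rw [ptmul, RelTensor.smul_tmul, Algebra.TensorProduct.tmul_mul_tmul]
  rfl

@[simp] theorem pFourierCoeff_ptmul_one (x : X k H) (f : H) (m : M) :
    pFourierCoeff x (ptmul f 1 m : P₂ k H M) = x (HopfAlgebra.antipode k f) • m := by
  rw [pFourierCoeff, LinearMap.comp_apply, LinearMap.comp_apply, pFourier_ptmul_one]
  simp [X.antip]

/-- The iterated comultiplication `H → (H ⊗ H) ⊗ H`. -/
noncomputable def Δ₃' (k H : Type*) [Field k] [Ring H] [HopfAlgebra k H] :
    H →ₐ[k] (H ⊗[k] H) ⊗[k] H :=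
  (Algebra.TensorProduct.map (Δ₂ k H) (AlgHom.id k H)).comp (Δ₂ k H)

theorem assoc_Δ₃' (h : H) :
    (Algebra.TensorProduct.assoc k k k H H H).toAlgHom (Δ₃' k H h) = Δ₃ k H h :=
  Δid_comul k h

theorem Δ₃'_apply (h : H) : Δ₃' k H h =
    Algebra.TensorProduct.map (Δ₂ k H) (AlgHom.id k H) (Δ₂ k H h) := rfl

theorem assoc_symm_Δ₃ (h : H) :
    (Algebra.TensorProduct.assoc k k k H H H).symm.toAlgHom (Δ₃ k H h) = Δ₃' k H h := by
  rw [← assoc_Δ₃']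
  exact (Algebra.TensorProduct.assoc k k k H H H).symm_apply_apply _

variable (M) in
/-- The map `H^{⊗3} ⊗_H M → (H^{⊗2} ⊗ H) ⊗_H M` given by reassociation. -/
noncomputable def reassoc : P₃ k H M →ₗ[k] RelTensor (Δ₃' k H) M :=
  RelTensor.map (Algebra.TensorProduct.assoc k k k H H H).symm.toAlgHom assoc_symm_Δ₃ M

omit [IsScalarTower k H M] in
theorem map_assoc_reassoc (z : P₃ k H M) :
    RelTensor.map (Algebra.TensorProduct.assoc k k k H H H).toAlgHom assoc_Δ₃' M
      (reassoc M z) = z := by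
  induction z using RelTensor.induction with
  | h0 => simp only [map_zero]
  | ha x y hx hy => simp only [map_add, hx, hy]
  | ht a m =>
    exact congrArg (fun a => RelTensor.tmul _ a m)
      ((Algebra.TensorProduct.assoc k k k H H H).apply_symm_apply a)

/-- After reassociation this is the Fourier isomorphism with B = H ⊗ H and α = Δ. -/
theorem P₃.induction {p : P₃ k H M → Prop} (h0 : p 0)
    (ht : ∀ f g m, p (RelTensor.tmul (Δ₃ k H) (f ⊗ₜ (g ⊗ₜ 1)) m))
    (ha : ∀ x y, p x → p y → p (x + y)) (z : P₃ k H M) : p z := by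
  rw [← map_assoc_reassoc z]
  generalize reassoc M z = w
  refine RelTensor.induction_tmul_one (p := fun w => p (RelTensor.map
    (Algebra.TensorProduct.assoc k k k H H H).toAlgHom assoc_Δ₃' M w))
    (Δ₂ k H) Δ₃'_apply ?_ (fun b m => ?_) (fun x y hx hy => ?_) w
  · rw [map_zero]; exact h0
  · rw [RelTensor.map_tmul]
    induction b using TensorProduct.induction_on with
    | zero =>
      simp only [TensorProduct.zero_tmul, map_zero, RelTensor.tmul]
      exact h0
    | add x y hx hy =>
      simp only [TensorProduct.add_tmul, map_add, RelTensor.tmul]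
      exact ha _ _ hx hy
    | tmul f g => exact ht f g m
  · rw [map_add]; exact ha _ _ hx hy

/-- For `x, y ∈ X`, the map `H^{⊗3} ⊗_H M → M`,
`(f ⊗ g ⊗ h) ⊗_H m ↦ ⟨S(x), f S(h₍₁₎)⟩ ⟨S(y), g S(h₍₂₎)⟩ h₍₃₎ m`. -/
noncomputable def fourierCoeff₃ (x y : X k H) : P₃ k H M →ₗ[k] M :=
  (TensorProduct.lid k M).toLinearMap ∘ₗ ((TensorProduct.lid k k).toLinearMap ∘ₗ
    TensorProduct.map (X.antip x) (X.antip y)).rTensor M ∘ₗ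
    fourier (Δ₂ k H) Δ₃'_apply ∘ₗ reassoc M

@[simp] theorem fourierCoeff₃_tmul (x y : X k H) (f g : H) (m : M) :
    fourierCoeff₃ x y (RelTensor.tmul (Δ₃ k H) (f ⊗ₜ (g ⊗ₜ 1)) m) =
      (x (HopfAlgebra.antipode k f) * y (HopfAlgebra.antipode k g)) • m := by
  have h1 : reassoc M (RelTensor.tmul (Δ₃ k H) (f ⊗ₜ (g ⊗ₜ 1)) m) =
    invFourier (Δ₃' k H) ((f ⊗ₜ g) ⊗ₜ m) := rfl
  simp only [fourierCoeff₃, LinearMap.comp_apply, h1, fourier_invFourier]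
  simp [X.antip]

end FourierTwo

/-! ### The identification of H^{⊗2} ⊗_H k with H -/

section Trivial

variable {k H : Type*} [Field k] [Ring H] [HopfAlgebra k H]

omit [Ring H] [HopfAlgebra k H] in
theorem Triv.val_add (c d : Triv k H) : (c + d).val = c.val + d.val := rfl

omit [Ring H] [HopfAlgebra k H] in
theorem Triv.val_smul (r : k) (c : Triv k H) : (r • c).val = r * c.val := rfl

/-- The isomorphism `H^{⊗2} ⊗_H k → H`, `(f ⊗ g) ⊗_H c ↦ c f S(g)`. -/
noncomputable def trivEval : P₂ k H (Triv k H) →ₗ[k] H :=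
  RelTensor.lift (TensorProduct.lift (LinearMap.mk₂ k
    (fun (ξ : H ⊗[k] H) (c : Triv k H) =>
      c.val • LinearMap.mul' k H ((HopfAlgebra.antipode k).lTensor H ξ))
    (fun ξ ξ' c => by rw [map_add, map_add, smul_add])
    (fun r ξ c => by rw [map_smul, map_smul, smul_comm])
    (fun ξ c c' => by rw [Triv.val_add, add_smul])
    (fun r ξ c => by rw [Triv.val_smul, mul_smul]))) <| by
    intro ξ h c
    have h1 : (h • c).val = (Coalgebra.counit h : k) * c.val := rfl
    simp only [TensorProduct.lift.tmul, LinearMap.mk₂_apply, h1]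
    rw [mul_comm, mul_smul]
    congr 1
    induction ξ using TensorProduct.induction_on with
    | zero => simp only [zero_mul, map_zero, smul_zero]
    | add x y hx hy => simp only [add_mul, map_add, smul_add, hx, hy]
    | tmul f g =>
      have h2 : ∀ z : H ⊗[k] H, LinearMap.mul' k H ((HopfAlgebra.antipode k).lTensor H
          ((f ⊗ₜ g) * z)) = f * LinearMap.mul' k H ((HopfAlgebra.antipode k).lTensor H z) *
            HopfAlgebra.antipode k g := by
        intro z
        induction z using TensorProduct.induction_on with
        | zero => simp only [mul_zero, zero_mul, map_zero]
        | add x y hx hy => simp only [mul_add, add_mul, map_add, hx, hy]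
        | tmul p q => simp [HopfAlgebra.antipode_mul_antidistrib, mul_assoc]
      -- Balancedness: f h₍₁₎ S(g h₍₂₎) = f h₍₁₎ S(h₍₂₎) S(g) = ε(h) f S(g).
      rw [h2, Bialgebra.comulAlgHom_apply, HopfAlgebra.mul_antipode_lTensor_comul_apply,
        Algebra.algebraMap_eq_smul_one]
      simp

theorem trivEval_ptmul (f g : H) (c : Triv k H) :
    trivEval (ptmul f g c) = c.val • (f * HopfAlgebra.antipode k g) := by
  simp [trivEval, ptmul]

theorem trivEval_smul (f g : H) (z : P₂ k H (Triv k H)) :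
    trivEval ((f ⊗ₜ[k] g) • z) = f * trivEval z * HopfAlgebra.antipode k g := by
  induction z using P₂.induction with
  | h0 => simp
  | ha x y hx hy => simp only [smul_add, map_add, mul_add, add_mul, hx, hy]
  | ht f' c => simp [smul_ptmul, trivEval_ptmul]

theorem ptmul_trivEval (z : P₂ k H (Triv k H)) : ptmul (trivEval z) 1 (Triv.of k H 1) = z := by
  induction z using P₂.induction with
  | h0 => simp [ptmul, RelTensor.tmul]
  | ha x y hx hy =>
    rw [map_add, ptmul_add_left, hx, hy]
  | ht f' c =>
    rw [trivEval_ptmul]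
    simp only [HopfAlgebra.antipode_one, mul_one, ptmul, RelTensor.tmul]
    rw [← TensorProduct.smul_tmul', TensorProduct.smul_tmul]
    congr 2
    exact mul_one (M := k) c

theorem trivEval_injective : Function.Injective (trivEval (k := k) (H := H)) :=
  Function.LeftInverse.injective (g := fun h => ptmul h 1 (Triv.of k H 1)) ptmul_trivEval

/-- This translates the Fourier coefficients of f ∈ V^* into ordinary functionals applied to
S(f(v)). -/
theorem val_pFourierCoeff (x : X k H) (z : P₂ k H (Triv k H)) :
    (pFourierCoeff x z).val = x (HopfAlgebra.antipode k (trivEval z)) := by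
  induction z using P₂.induction with
  | h0 =>
    simp only [map_zero]
    rfl
  | ha z w hz hw =>
    simp only [map_add, ← hz, ← hw]
    rfl
  | ht f c =>
    rw [pFourierCoeff_ptmul_one, trivEval_ptmul]
    simp only [HopfAlgebra.antipode_one, mul_one, map_smul, smul_eq_mul]
    exact mul_comm (G := k) _ _

end Trivial

/-! ### Elements of the pseudo-dual as functions V → H -/

section PDual

variable {k H : Type*} [Field k] [Ring H] [HopfAlgebra k H]
  {V : Type*} [AddCommGroup V] [Module k V] [Module H V]

namespace PDual

/-- The function `V → H` corresponding to `φ ∈ V^*` under the isomorphism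
`H^{⊗2} ⊗_H k → H`, `(f ⊗ g) ⊗_H c ↦ c f S(g)`. -/
noncomputable def fn : PDual k H V →ₗ[k] (V →ₗ[k] H) :=
  LinearMap.compRight k trivEval ∘ₗ (Chom k H V (Triv k H)).subtype

theorem fn_apply (φ : PDual k H V) (v : V) : fn φ v = trivEval (φ.1 v) := rfl

theorem fn_smul (h : H) (φ : PDual k H V) (v : V) : fn (h • φ) v = h * fn φ v := by
  rw [fn_apply, Chom.smul_apply, trivEval_smul, HopfAlgebra.antipode_one, mul_one, fn_apply]

theorem fn_apply_smul (φ : PDual k H V) (h : H) (v : V) :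
    fn φ (h • v) = fn φ v * HopfAlgebra.antipode k h := by
  rw [fn_apply, φ.2, trivEval_smul, one_mul, fn_apply]

theorem fn_injective : Function.Injective (fn (k := k) (H := H) (V := V)) := by
  intro φ ψ h
  refine Subtype.ext (LinearMap.ext fun v => trivEval_injective ?_)
  exact LinearMap.congr_fun h v

/-- The element of `V^*` with a given corresponding function `V → H`. -/
noncomputable def ofFn (F : V →ₗ[k] H)
    (hF : ∀ (h : H) v, F (h • v) = F v * HopfAlgebra.antipode k h) : PDual k H V :=
  ⟨RelTensor.proj (Δ₂ k H) (Triv k H) ∘ₗ (TensorProduct.mk k (H ⊗[k] H) (Triv k H)).flip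
    (Triv.of k H 1) ∘ₗ (TensorProduct.mk k H H).flip 1 ∘ₗ F, by
    intro h v
    apply trivEval_injective
    rw [trivEval_smul, one_mul]
    change trivEval (ptmul (F (h • v)) 1 (Triv.of k H 1)) =
      trivEval (ptmul (F v) 1 (Triv.of k H 1)) * _
    rw [trivEval_ptmul, trivEval_ptmul, hF]
    simp⟩

@[simp] theorem fn_ofFn (F : V →ₗ[k] H)
    (hF : ∀ (h : H) v, F (h • v) = F v * HopfAlgebra.antipode k h) : fn (ofFn F hF) = F := by
  ext v
  rw [fn_apply]
  change trivEval (ptmul (F v) 1 (Triv.of k H 1)) = _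
  rw [trivEval_ptmul]
  simp [Triv.val, Triv.of]

theorem coeff_eq (φ : PDual k H V) (x : X k H) (v : V) :
    φ.coeff x v = x (HopfAlgebra.antipode k (fn φ v)) :=
  val_pFourierCoeff x _

end PDual

end PDual

/-! ### Naturality of the symmetry and associativity maps -/

section TensorMaps

variable {k M N P M' N' P' : Type*} [Field k] [AddCommMonoid M] [Module k M] [AddCommMonoid N]
  [Module k N] [AddCommMonoid P] [Module k P] [AddCommMonoid M'] [Module k M']
  [AddCommMonoid N'] [Module k N'] [AddCommMonoid P'] [Module k P']
  (f : M →ₗ[k] M') (g : N →ₗ[k] N') (e : P →ₗ[k] P')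

theorem map_leftComm (t : N ⊗[k] (M ⊗[k] P)) :
    TensorProduct.map f (TensorProduct.map g e) (TensorProduct.leftComm k N M P t) =
      TensorProduct.leftComm k N' M' P' (TensorProduct.map g (TensorProduct.map f e) t) := by
  have h : TensorProduct.map f (TensorProduct.map g e) ∘ₗ
      (TensorProduct.leftComm k N M P).toLinearMap =
      (TensorProduct.leftComm k N' M' P').toLinearMap ∘ₗ
        TensorProduct.map g (TensorProduct.map f e) := by
    ext a b c
    rfl
  exact LinearMap.congr_fun h t

theorem map_assoc (t : (M ⊗[k] N) ⊗[k] P) :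
    TensorProduct.map f (TensorProduct.map g e) (TensorProduct.assoc k M N P t) =
      TensorProduct.assoc k M' N' P' (TensorProduct.map (TensorProduct.map f g) e t) := by
  have h : TensorProduct.map f (TensorProduct.map g e) ∘ₗ
      (TensorProduct.assoc k M N P).toLinearMap =
      (TensorProduct.assoc k M' N' P').toLinearMap ∘ₗ
        TensorProduct.map (TensorProduct.map f g) e := by
    ext a b c
    rfl
  exact LinearMap.congr_fun h t

theorem map_comm (t : N ⊗[k] M) :
    TensorProduct.map f g (TensorProduct.comm k N M t) =
      TensorProduct.comm k N' M' (TensorProduct.map g f t) := by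
  have h : TensorProduct.map f g ∘ₗ (TensorProduct.comm k N M).toLinearMap =
      (TensorProduct.comm k N' M').toLinearMap ∘ₗ TensorProduct.map g f := by
    ext a b
    rfl
  exact LinearMap.congr_fun h t

end TensorMaps

/-! ### Evaluation of A ⊗_H V^* at points of V -/

section Evaluation

variable {k H : Type*} [Field k] [Ring H] [HopfAlgebra k H]
  {V : Type*} [AddCommGroup V] [Module k V] [Module H V]

namespace PDual

/-- The evaluation of `fn φ` at `v`, as a linear map in `φ`. -/
noncomputable def fnAt (v : V) : PDual k H V →ₗ[k] H := LinearMap.applyₗ v ∘ₗ fn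

@[simp] theorem fnAt_apply (v : V) (φ : PDual k H V) : fnAt v φ = fn φ v := rfl

theorem eq_of_fnAt {φ ψ : PDual k H V} (h : ∀ v, fnAt v φ = fnAt v ψ) : φ = ψ :=
  fn_injective (LinearMap.ext h)

theorem equivFinsuppOfBasisLeft_lTensor {ι W D E : Type*} [DecidableEq ι] [AddCommMonoid W]
    [Module k W] [AddCommMonoid D] [Module k D] [AddCommMonoid E] [Module k E]
    (b : Module.Basis ι k W) (f : D →ₗ[k] E) (t : W ⊗[k] D) (i : ι) :
    TensorProduct.equivFinsuppOfBasisLeft b (f.lTensor W t) i =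
      f (TensorProduct.equivFinsuppOfBasisLeft b t i) := by
  induction t using TensorProduct.induction_on with
  | zero => simp only [map_zero, Finsupp.coe_zero, Pi.zero_apply]
  | add x y hx hy => simp only [map_add, Finsupp.coe_add, Pi.add_apply, hx, hy]
  | tmul w d => simp

/-- Joint injectivity survives tensoring over a field: along a basis of W, each coordinate of t lies
in D and is separated by the f v. No finiteness is needed. -/
theorem eq_of_lTensor {κ W D E : Type*} [AddCommGroup W] [Module k W] [AddCommMonoid D]
    [Module k D] [AddCommMonoid E] [Module k E] (f : κ → D →ₗ[k] E)
    (hf : ∀ d d', (∀ v, f v d = f v d') → d = d') {t t' : W ⊗[k] D}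
    (h : ∀ v, (f v).lTensor W t = (f v).lTensor W t') : t = t' := by
  classical
  let b := Module.Basis.ofVectorSpace k W
  refine (TensorProduct.equivFinsuppOfBasisLeft b).injective (Finsupp.ext fun i => ?_)
  refine hf _ _ fun v => ?_
  rw [← equivFinsuppOfBasisLeft_lTensor, ← equivFinsuppOfBasisLeft_lTensor, h]

theorem eq_of_lTensor_fnAt {W : Type*} [AddCommGroup W] [Module k W]
    {t t' : W ⊗[k] PDual k H V}
    (h : ∀ v, (fnAt v).lTensor W t = (fnAt v).lTensor W t') : t = t' :=
  eq_of_lTensor fnAt (fun _ _ => eq_of_fnAt) h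

theorem eq_of_rTensor_fnAt {W : Type*} [AddCommGroup W] [Module k W]
    {t t' : PDual k H V ⊗[k] W}
    (h : ∀ v, (fnAt v).rTensor W t = (fnAt v).rTensor W t') : t = t' := by
  refine (TensorProduct.comm k _ _).injective (eq_of_lTensor_fnAt fun v => ?_)
  rw [← LinearMap.comm_comp_rTensor_comp_comm_eq]
  simp [h]

theorem eq_of_map_fnAt {V' : Type*} [AddCommGroup V'] [Module k V'] [Module H V']
    {t t' : PDual k H V ⊗[k] PDual k H V'}
    (h : ∀ u v, TensorProduct.map (fnAt u) (fnAt v) t =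
      TensorProduct.map (fnAt u) (fnAt v) t') : t = t' := by
  refine eq_of_rTensor_fnAt fun u => eq_of_lTensor_fnAt fun v => ?_
  rw [← LinearMap.comp_apply, ← LinearMap.comp_apply, LinearMap.lTensor_comp_rTensor]
  exact h u v

theorem eq_of_map_fnAt₃ {t t' : PDual k H V ⊗[k] (PDual k H V ⊗[k] PDual k H V)}
    (h : ∀ u v w, TensorProduct.map (fnAt u) (TensorProduct.map (fnAt v) (fnAt w)) t =
      TensorProduct.map (fnAt u) (TensorProduct.map (fnAt v) (fnAt w)) t') : t = t' := by
  refine eq_of_rTensor_fnAt (W := PDual k H V ⊗[k] PDual k H V) fun u => ?_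
  refine eq_of_lTensor (fun v : V × V => TensorProduct.map (fnAt (k := k) (H := H) v.1) (fnAt v.2))
    (fun d d' hd => eq_of_map_fnAt fun u v => hd (u, v)) fun v => ?_
  rw [← LinearMap.comp_apply, ← LinearMap.comp_apply, LinearMap.lTensor_comp_rTensor]
  exact h u v.1 v.2

/-- The evaluation at `v` of an element of `A ⊗_H V^*`: `a ⊗_H φ ↦ a Δ(φ(v))`. -/
noncomputable def evAt {A : Type*} [Ring A] [Algebra k A] (Δ : H →ₐ[k] A) (v : V) :
    RelTensor Δ (PDual k H V) →ₗ[k] A :=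
  RelTensor.lift (LinearMap.mul' k A ∘ₗ (Δ.toLinearMap ∘ₗ fnAt v).lTensor A) <| by
    intro a h φ
    simp [fn_smul, mul_assoc]

section

variable {A B : Type*} [Ring A] [Algebra k A] [Ring B] [Algebra k B]

@[simp] theorem evAt_tmul (Δ : H →ₐ[k] A) (v : V) (a : A) (φ : PDual k H V) :
    evAt Δ v (RelTensor.tmul Δ a φ) = a * Δ (fn φ v) := by
  simp [evAt]

theorem evAt_smul (Δ : H →ₐ[k] A) (v : V) (a : A) (z : RelTensor Δ (PDual k H V)) :
    evAt Δ v (a • z) = a * evAt Δ v z := by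
  induction z using RelTensor.induction with
  | h0 => simp only [smul_zero, map_zero, mul_zero]
  | ha x y hx hy => simp only [smul_add, map_add, mul_add, hx, hy]
  | ht b m => rw [RelTensor.smul_tmul, evAt_tmul, evAt_tmul, mul_assoc]

theorem evAt_map {Δ : H →ₐ[k] A} {Δ' : H →ₐ[k] B} (F : A →ₐ[k] B) (hF : ∀ h, F (Δ h) = Δ' h)
    (v : V) (z : RelTensor Δ (PDual k H V)) :
    evAt Δ' v (RelTensor.map F hF _ z) = F (evAt Δ v z) := by
  induction z using RelTensor.induction with
  | h0 => simp only [map_zero]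
  | ha x y hx hy => simp only [map_add, hx, hy]
  | ht b m => rw [RelTensor.map_tmul, evAt_tmul, evAt_tmul, map_mul, hF]

/-- In Fourier coordinates, evaluation is id ⊗ ev_v followed by the bijection `twist α`. Both the
injectivity statement `eq_of_evAt` and the surjectivity statement `exists_evAt_eq` rest on this. -/
theorem evAt_invFourier {Δ : H →ₐ[k] B ⊗[k] H} (α : H →ₐ[k] B)
    (hΔ : ∀ h, Δ h = Algebra.TensorProduct.map α (AlgHom.id k H) (Δ₂ k H h)) (v : V)
    (t : B ⊗[k] PDual k H V) :
    evAt Δ v (invFourier Δ t) = twist α ((fnAt v).lTensor B t) := by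
  induction t using TensorProduct.induction_on with
  | zero => simp only [map_zero]
  | add x y hx hy => simp only [map_add, hx, hy]
  | tmul b φ =>
    rw [invFourier_tmul, evAt_tmul, LinearMap.lTensor_tmul, twist_tmul, hΔ]
    rfl

theorem eq_of_evAt {Δ : H →ₐ[k] B ⊗[k] H} (α : H →ₐ[k] B)
    (hΔ : ∀ h, Δ h = Algebra.TensorProduct.map α (AlgHom.id k H) (Δ₂ k H h))
    {z w : RelTensor Δ (PDual k H V)} (h : ∀ v, evAt Δ v z = evAt Δ v w) : z = w := by
  rw [← invFourier_fourier α hΔ z, ← invFourier_fourier α hΔ w]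
  congr 1
  refine eq_of_lTensor_fnAt fun v => ?_
  rw [← untwist_twist α (LinearMap.lTensor _ _ _), ← evAt_invFourier α hΔ, invFourier_fourier, h,
    ← untwist_twist α (LinearMap.lTensor _ _ (fourier α hΔ w)), ← evAt_invFourier α hΔ,
    invFourier_fourier]

end

theorem eq_of_evAt₂ {z w : P₂ k H (PDual k H V)}
    (h : ∀ v, evAt (Δ₂ k H) v z = evAt (Δ₂ k H) v w) : z = w :=
  eq_of_evAt (AlgHom.id k H) Δ₂_eq_map_id h

theorem eq_of_evAt₃ {z w : P₃ k H (PDual k H V)}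
    (h : ∀ v, evAt (Δ₃ k H) v z = evAt (Δ₃ k H) v w) : z = w := by
  rw [← map_assoc_reassoc z, ← map_assoc_reassoc w]
  congr 1
  refine eq_of_evAt (Δ₂ k H) Δ₃'_apply fun v => ?_
  rw [reassoc, evAt_map, evAt_map, h]

theorem fnAt_pFourierCoeff (v : V) (x : X k H) (z : P₂ k H (PDual k H V)) :
    fnAt v (pFourierCoeff x z) =
      TensorProduct.lid k H ((X.antip x).rTensor H (fourierAux (evAt (Δ₂ k H) v z))) := by
  induction z using P₂.induction with
  | h0 => simp only [map_zero]
  | ha x y hx hy => simp only [map_add, hx, hy]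
  | ht f φ =>
    have h1 : evAt (Δ₂ k H) v (ptmul f 1 φ) = twist (AlgHom.id k H) (f ⊗ₜ fn φ v) :=
      evAt_invFourier (AlgHom.id k H) Δ₂_eq_map_id v (f ⊗ₜ φ)
    rw [h1, ← untwist_id, untwist_twist, pFourierCoeff_ptmul_one]
    simp [X.antip]

/-- Untwisting turns right multiplication by Δ(S(h)) into right multiplication by 1 ⊗ S(h). Hence,
if the untwisted Θ is ∑ b_i ⊗ Ψ_i along a basis b_i of H, each Ψ_i is itself an element of V^*.
Finite generation of V makes the sum finite, and ∑ (b_i ⊗ 1) ⊗_H Ψ_i is the required element. -/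
theorem exists_evAt_eq [Module.Finite H V] (Θ : V →ₗ[k] H ⊗[k] H)
    (hΘ : ∀ (h : H) v, Θ (h • v) = Θ v * Δ₂ k H (HopfAlgebra.antipode k h)) :
    ∃ z : P₂ k H (PDual k H V), ∀ v, evAt (Δ₂ k H) v z = Θ v := by
  classical
  let b := Module.Basis.ofVectorSpace k H
  let E := TensorProduct.equivFinsuppOfBasisLeft (N := H) b
  have hE : ∀ (w : H ⊗[k] H) (h : H) i, E (w * ((1 : H) ⊗ₜ h)) i = E w i * h := by
    intro w h i
    induction w using TensorProduct.induction_on with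
    | zero => simp only [zero_mul, map_zero, Finsupp.coe_zero, Pi.zero_apply]
    | add x y hx hy => simp only [add_mul, map_add, Finsupp.coe_add, Pi.add_apply, hx, hy]
    | tmul p q => simp [E]
  let Ψ := fun i => Finsupp.lapply i ∘ₗ E.toLinearMap ∘ₗ untwist (AlgHom.id k H) ∘ₗ Θ
  have hΨ : ∀ i (h : H) v, Ψ i (h • v) = Ψ i v * HopfAlgebra.antipode k h := by
    intro i h v
    change E (untwist (AlgHom.id k H) (Θ (h • v))) i = E (untwist (AlgHom.id k H) (Θ v)) i * _
    rw [hΘ, Δ₂_eq_map_id, untwist_mul_right, hE]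
  obtain ⟨S, hS⟩ := (Module.Finite.fg_top : (⊤ : Submodule H V).FG)
  -- The indices occurring at a finite set of generators. By equivariance, Ψ_i vanishes identically
  -- as soon as it vanishes on the generators.
  let I := S.biUnion fun s => (E (untwist (AlgHom.id k H) (Θ s))).support
  have hI : ∀ i ∉ I, ∀ v, Ψ i v = 0 := by
    intro i hi v
    have hv : v ∈ Submodule.span H (S : Set V) := hS ▸ Submodule.mem_top
    induction hv using Submodule.span_induction with
    | mem s hs =>
      by_contra h
      exact hi (Finset.mem_biUnion.2 ⟨s, hs, Finsupp.mem_support_iff.2 h⟩)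
    | zero => rw [map_zero]
    | add x y _ _ hx hy => rw [map_add, hx, hy, add_zero]
    | smul h x _ hx => rw [hΨ, hx, zero_mul]
  refine ⟨invFourier (Δ₂ k H) (∑ i ∈ I, b i ⊗ₜ ofFn (Ψ i) (hΨ i)), fun v => ?_⟩
  rw [evAt_invFourier (AlgHom.id k H) Δ₂_eq_map_id, ← twist_untwist (AlgHom.id k H) (Θ v)]
  congr 1
  apply E.injective
  ext j
  rw [equivFinsuppOfBasisLeft_lTensor]
  change _ = Ψ j v
  rw [map_sum, Finsupp.finsetSum_apply, map_sum]
  by_cases hj : j ∈ I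
  · rw [Finset.sum_eq_single j]
    · simp
    · intro i _ hij
      simp [hij]
    · exact fun h => absurd hj h
  · rw [hI j hj]
    refine Finset.sum_eq_zero fun i hi => ?_
    have hij : i ≠ j := fun h => hj (h ▸ hi)
    simp [hij]

end PDual

end Evaluation

/-! ### The Lie pseudoalgebra dual to a finite Lie coalgebra -/

section DualBracket

variable {k H : Type*} [Field k] [Ring H] [HopfAlgebra k H]

@[simp] theorem outerAct_tmul {M N : Type*} [AddCommGroup M] [Module k M] [Module H M]
    [IsScalarTower k H M] [AddCommGroup N] [Module k N] [Module H N] [IsScalarTower k H N]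
    (f g : H) (m : M) (n : N) :
    outerAct (k := k) (f ⊗ₜ[k] g) (m ⊗ₜ[k] n) = (f • m) ⊗ₜ[k] (g • n) := rfl

variable {R : Type*} [AddCommGroup R] [Module k R] [Module H R] [IsScalarTower k H R]

namespace PDual

theorem map_fn_outerAct (f g : PDual k H R) (w : H ⊗[k] H) (z : R ⊗[k] R) :
    TensorProduct.map (fn f) (fn g) (outerAct w z) =
      TensorProduct.map (fn f) (fn g) z * antipode₂ k H w := by
  induction w using TensorProduct.induction_on with
  | zero => simp only [map_zero, mul_zero, LinearMap.zero_apply]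
  | add x y hx hy => simp only [map_add, LinearMap.add_apply, mul_add, hx, hy]
  | tmul p q =>
    induction z using TensorProduct.induction_on with
    | zero => simp only [map_zero, zero_mul]
    | add x y hx hy => simp only [map_add, add_mul, hx, hy]
    | tmul m n => simp [fn_apply_smul]

omit [IsScalarTower k H R] in
theorem map_fn_smul (p q : H) (f g : PDual k H R) (z : R ⊗[k] R) :
    TensorProduct.map (fn (p • f)) (fn (q • g)) z =
      (p ⊗ₜ[k] q) * TensorProduct.map (fn f) (fn g) z := by
  induction z using TensorProduct.induction_on with
  | zero => simp only [map_zero, mul_zero]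
  | add x y hx hy => simp only [map_add, mul_add, hx, hy]
  | tmul m n => simp [fn_smul]

/-- H-linearity of δ produces the factor (S ⊗ S)Δ(h) on the right, which is Δ(S(h)) by
cocommutativity. This is the equivariance demanded by `exists_evAt_eq`. -/
theorem exists_prod [Coalgebra.IsCocomm k H] [Module.Finite H R] (δ : R →ₗ[k] R ⊗[k] R)
    (hδ : ∀ (h : H) (r : R), δ (h • r) = diagAct h (δ r)) (f g : PDual k H R) :
    ∃ z : P₂ k H (PDual k H R),
      ∀ r, evAt (Δ₂ k H) r z = TensorProduct.map (fn f) (fn g) (δ r) := by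
  refine exists_evAt_eq (TensorProduct.map (fn f) (fn g) ∘ₗ δ) fun h r => ?_
  rw [LinearMap.comp_apply, hδ, diagAct, map_fn_outerAct, comul_antipode]
  rfl

end PDual

open PDual

variable [Coalgebra.IsCocomm k H] [Module.Finite H R] (δ : R →ₗ[k] R ⊗[k] R)
  (hδ : ∀ (h : H) (r : R), δ (h • r) = diagAct h (δ r))

/-- The element of `H^{⊗2} ⊗_H R^*` with value `∑ f(r₍₁₎) ⊗ g(r₍₂₎)` at `r`. -/
noncomputable def dualProd (f g : PDual k H R) : P₂ k H (PDual k H R) :=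
  (exists_prod δ hδ f g).choose

theorem evAt_dualProd (f g : PDual k H R) (r : R) :
    evAt (Δ₂ k H) r (dualProd δ hδ f g) = TensorProduct.map (fn f) (fn g) (δ r) :=
  (exists_prod δ hδ f g).choose_spec r

/-- The pseudoproduct on `R^*` dual to an `H`-linear map `δ : R → R ⊗ R`. -/
noncomputable def dualPseudoproduct : Pseudoproduct k H (PDual k H R) where
  prod := LinearMap.mk₂ k (dualProd δ hδ)
    (fun f f' g => eq_of_evAt₂ fun v => by
      simp only [map_add, evAt_dualProd, TensorProduct.map_add_left, LinearMap.add_apply])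
    (fun c f g => eq_of_evAt₂ fun v => by
      simp only [map_smul, evAt_dualProd, TensorProduct.map_smul_left, LinearMap.smul_apply])
    (fun f g g' => eq_of_evAt₂ fun v => by
      simp only [map_add, evAt_dualProd, TensorProduct.map_add_right, LinearMap.add_apply])
    (fun c f g => eq_of_evAt₂ fun v => by
      simp only [map_smul, evAt_dualProd, TensorProduct.map_smul_right, LinearMap.smul_apply])
  bilin p q f g := eq_of_evAt₂ fun v => by
    rw [LinearMap.mk₂_apply, LinearMap.mk₂_apply, evAt_smul, evAt_dualProd, evAt_dualProd,
      map_fn_smul]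

theorem evAt_dualPseudoproduct (f g : PDual k H R) (r : R) :
    evAt (Δ₂ k H) r ((dualPseudoproduct δ hδ).prod f g) =
      TensorProduct.map (fn f) (fn g) (δ r) :=
  evAt_dualProd δ hδ f g r

/-- Evaluation turns composition of pseudoproducts into iteration of δ: for z = [g * e] the right
side is (f ⊗ g ⊗ e)(id ⊗ δ)δ(r). `evAt_compLeft` is the counterpart for (δ ⊗ id)δ. -/
theorem evAt_compRight (f : PDual k H R) (z : P₂ k H (PDual k H R)) (r : R) {n : ℕ}
    {u v : Fin n → R} (hr : δ r = ∑ s, u s ⊗ₜ[k] v s) :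
    evAt (Δ₃ k H) r ((dualPseudoproduct δ hδ).compRight f z) =
      ∑ s, fn f (u s) ⊗ₜ[k] evAt (Δ₂ k H) (v s) z := by
  induction z using RelTensor.induction with
  | h0 => simp only [map_zero, TensorProduct.tmul_zero, Finset.sum_const_zero]
  | ha x y hx hy => simp only [map_add, TensorProduct.tmul_add, Finset.sum_add_distrib, hx, hy]
  | ht a φ =>
    have h1 : (dualPseudoproduct δ hδ).compRight f (RelTensor.tmul (Δ₂ k H) a φ) =
      ((1 : H) ⊗ₜ[k] a) • expandRight _ ((dualPseudoproduct δ hδ).prod f φ) := rfl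
    rw [h1, evAt_smul, expandRight, evAt_map, evAt_dualPseudoproduct, hr, map_sum, map_sum,
      Finset.mul_sum]
    refine Finset.sum_congr rfl fun s _ => ?_
    simp [idΔ]

theorem evAt_compLeft (f : PDual k H R) (z : P₂ k H (PDual k H R)) (r : R) {n : ℕ}
    {u v : Fin n → R} (hr : δ r = ∑ s, u s ⊗ₜ[k] v s) :
    evAt (Δ₃ k H) r ((dualPseudoproduct δ hδ).compLeft f z) =
      ∑ s, Algebra.TensorProduct.assoc k k k H H H
        (evAt (Δ₂ k H) (u s) z ⊗ₜ[k] fn f (v s)) := by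
  induction z using RelTensor.induction with
  | h0 => simp only [map_zero, TensorProduct.zero_tmul, Finset.sum_const_zero]
  | ha x y hx hy => simp only [map_add, TensorProduct.add_tmul, Finset.sum_add_distrib, hx, hy]
  | ht a φ =>
    have h1 : (dualPseudoproduct δ hδ).compLeft f (RelTensor.tmul (Δ₂ k H) a φ) =
      (Algebra.TensorProduct.assoc k k k H H H (a ⊗ₜ[k] (1 : H))) •
        expandLeft _ ((dualPseudoproduct δ hδ).prod φ f) := rfl
    rw [h1, evAt_smul, expandLeft, evAt_map, evAt_dualPseudoproduct, hr, map_sum, map_sum,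
      Finset.mul_sum]
    refine Finset.sum_congr rfl fun s _ => ?_
    have h2 : Δid k H (TensorProduct.map (fn φ) (fn f) (u s ⊗ₜ[k] v s)) =
      Algebra.TensorProduct.assoc k k k H H H
        (Δ₂ k H (fn φ (u s)) ⊗ₜ[k] fn f (v s)) := rfl
    rw [h2, ← map_mul, Algebra.TensorProduct.tmul_mul_tmul, one_mul, evAt_tmul]

omit [IsScalarTower k H R] [Module.Finite H R] in
theorem evAt_swap₂ (z : P₂ k H (PDual k H R)) (r : R) : evAt (Δ₂ k H) r (swap₂ _ z) =
    Algebra.TensorProduct.comm k H H (evAt (Δ₂ k H) r z) :=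
  evAt_map _ _ r z

omit [IsScalarTower k H R] [Module.Finite H R] in
theorem evAt_swap₃ (z : P₃ k H (PDual k H R)) (r : R) : evAt (Δ₃ k H) r (swap₃ _ z) =
    Algebra.TensorProduct.leftComm k H H H (evAt (Δ₃ k H) r z) :=
  evAt_map _ _ r z

omit [Module k R] [Module H R] [IsScalarTower k H R] [Module.Finite H R] in
theorem exists_fin_sum_tmul [Module k R] (z : R ⊗[k] R) :
    ∃ (n : ℕ) (u v : Fin n → R), z = ∑ s, u s ⊗ₜ[k] v s := by
  obtain ⟨S, rfl⟩ := TensorProduct.exists_finset z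
  refine ⟨S.card, fun s => (S.equivFin.symm s).1.1, fun s => (S.equivFin.symm s).1.2, ?_⟩
  rw [← Finset.sum_coe_sort]
  exact (Equiv.sum_comp S.equivFin.symm fun i => i.1.1 ⊗ₜ[k] i.1.2).symm

/-- Values separate points, so each Lie axiom may be tested at r. There it is the corresponding
coalgebra axiom with f ⊗ g or f ⊗ g ⊗ e applied to it. -/
theorem isLie_dualPseudoproduct (h : IsLieCoalgebra (H := H) δ) :
    (dualPseudoproduct δ h.map_act).IsLie where
  skew f g := eq_of_evAt₂ fun r => by
    rw [map_neg, evAt_swap₂, evAt_dualPseudoproduct, evAt_dualPseudoproduct]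
    have h1 : δ r = - TensorProduct.comm k R R (δ r) := by rw [h.skew, neg_neg]
    conv_lhs => rw [h1, map_neg]
    congr 1
    exact map_comm (fn g) (fn f) (δ r)
  jacobi f g e := eq_of_evAt₃ fun r => by
    obtain ⟨n, u, v, hr⟩ := exists_fin_sum_tmul (δ r)
    have h1 : ∀ f g e : PDual k H R, evAt (Δ₃ k H) r
        ((dualPseudoproduct δ h.map_act).compRight f
          ((dualPseudoproduct δ h.map_act).prod g e)) =
        TensorProduct.map (fn f) (TensorProduct.map (fn g) (fn e)) (δ.lTensor R (δ r)) := by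
      intro f g e
      rw [evAt_compRight _ _ _ _ _ hr, hr, map_sum, map_sum]
      simp only [evAt_dualPseudoproduct]
      rfl
    have h2 : evAt (Δ₃ k H) r ((dualPseudoproduct δ h.map_act).compLeft e
          ((dualPseudoproduct δ h.map_act).prod f g)) =
        TensorProduct.map (fn f) (TensorProduct.map (fn g) (fn e))
          (TensorProduct.assoc k R R R (δ.rTensor R (δ r))) := by
      rw [evAt_compLeft _ _ _ _ _ hr, hr, map_sum, map_sum, map_sum]
      refine Finset.sum_congr rfl fun s _ => ?_
      rw [evAt_dualPseudoproduct, LinearMap.rTensor_tmul]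
      generalize δ (u s) = z
      induction z using TensorProduct.induction_on with
      | zero => simp only [map_zero, TensorProduct.zero_tmul]
      | add x y hx hy => simp only [map_add, TensorProduct.add_tmul, hx, hy]
      | tmul m n => rfl
    rw [map_sub, evAt_swap₃, h1, h1, h2, ← h.coJacobi, map_sub]
    congr 1
    exact (map_leftComm (fn f) (fn g) (fn e) _).symm

end DualBracket

/-! ### Finite sums over dual bases -/

section FiniteSum

variable {ι M : Type*} [AddCommMonoid M]

theorem IsFiniteSum.zero : IsFiniteSum (fun _ : ι => (0 : M)) 0 :=
  ⟨by simp [Function.support_fun_zero], finsum_zero⟩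

theorem IsFiniteSum.add {f g : ι → M} {s t : M} (hf : IsFiniteSum f s) (hg : IsFiniteSum g t) :
    IsFiniteSum (fun i => f i + g i) (s + t) := by
  refine ⟨(hf.1.union hg.1).subset (Function.support_add f g), ?_⟩
  rw [finsum_add_distrib hf.1 hg.1, hf.2, hg.2]

variable {k H : Type*} [Field k] [Ring H] [HopfAlgebra k H] {M : Type*} [AddCommGroup M]
  [Module k M]

theorem isFiniteSum_coord (e : Module.Basis ι k H) (h : H) (Q : H →ₗ[k] M) :
    IsFiniteSum (fun i => e.coord i h • Q (e i)) (Q h) := by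
  have hs : (Function.support fun i => e.coord i h • Q (e i)) ⊆ ((e.repr h).support : Set ι) := by
    intro i hi
    refine Finsupp.mem_support_iff.2 fun h0 => hi ?_
    change e.repr h i • Q (e i) = 0
    rw [h0, zero_smul]
  refine ⟨(Finset.finite_toSet _).subset hs, ?_⟩
  rw [finsum_eq_sum_of_support_subset _ hs]
  conv_rhs => rw [← e.linearCombination_repr h, Finsupp.linearCombination_apply, Finsupp.sum,
    map_sum]
  exact Finset.sum_congr rfl fun i _ => (map_smul Q _ _).symm

theorem IsSweedlerSum.zero (e : Module.Basis ι k H) (x : X k H) :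
    IsSweedlerSum e x (fun _ _ => (0 : M)) 0 := by
  unfold IsSweedlerSum
  simp only [smul_zero]
  exact IsFiniteSum.zero

theorem IsSweedlerSum.add {e : Module.Basis ι k H} {x : X k H} {Φ Ψ : X k H → X k H → M} {s t : M}
    (hΦ : IsSweedlerSum e x Φ s) (hΨ : IsSweedlerSum e x Ψ t) :
    IsSweedlerSum e x (fun x₁ x₂ => Φ x₁ x₂ + Ψ x₁ x₂) (s + t) := by
  unfold IsSweedlerSum
  simp only [smul_add]
  exact IsFiniteSum.add hΦ hΨ

theorem IsSweedlerSum.sum {κ : Type*} (S : Finset κ) {e : Module.Basis ι k H} {x : X k H}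
    {Φ : κ → X k H → X k H → M} {s : κ → M} (h : ∀ j, IsSweedlerSum e x (Φ j) (s j)) :
    IsSweedlerSum e x (fun x₁ x₂ => ∑ j ∈ S, Φ j x₁ x₂) (∑ j ∈ S, s j) := by
  classical
  induction S using Finset.induction_on with
  | empty => simpa only [Finset.sum_empty] using IsSweedlerSum.zero e x
  | insert a S ha ih =>
    simp only [Finset.sum_insert ha]
    exact (h a).add ih

/-- Expand p and q along the basis; only indices in their supports contribute. The Sweedler sums
below reduce to this case, which says that the coproduct of X is dual to the product of H. -/
theorem isSweedlerSum_tmul (e : Module.Basis ι k H) (x : X k H) (p q : H) (m : M) :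
    IsSweedlerSum e x (fun x₁ x₂ => (x₁ p * x₂ q) • m) (x (p * q) • m) := by
  have hs : (Function.support fun i : ι × ι => X.comul x (e i.1 ⊗ₜ[k] e i.2) •
      (e.coord i.1 p * e.coord i.2 q) • m) ⊆
        (((e.repr p).support ×ˢ (e.repr q).support : Finset (ι × ι)) : Set (ι × ι)) := by
    intro i hi
    refine Finset.mem_product.2 ⟨Finsupp.mem_support_iff.2 fun h0 => hi ?_,
      Finsupp.mem_support_iff.2 fun h0 => hi ?_⟩
    · change _ • (e.repr p i.1 * e.repr q i.2) • m = 0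
      rw [h0, zero_mul, zero_smul, smul_zero]
    · change _ • (e.repr p i.1 * e.repr q i.2) • m = 0
      rw [h0, mul_zero, zero_smul, smul_zero]
  refine ⟨(Finset.finite_toSet _).subset hs, ?_⟩
  rw [finsum_eq_sum_of_support_subset _ hs, Finset.sum_product]
  conv_rhs => rw [← e.linearCombination_repr p, ← e.linearCombination_repr q,
    Finsupp.linearCombination_apply, Finsupp.linearCombination_apply, Finsupp.sum, Finsupp.sum,
    Finset.sum_mul_sum, map_sum, Finset.sum_smul]
  refine Finset.sum_congr rfl fun i _ => ?_
  rw [map_sum, Finset.sum_smul]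
  refine Finset.sum_congr rfl fun j _ => ?_
  rw [smul_smul, smul_mul_smul_comm, map_smul, smul_eq_mul, mul_comm]
  rfl

end FiniteSum

/-! ### From Lie pseudoalgebras to Lie conformal algebras -/

section Conformal

variable {k : Type*} {H : Type v} [Field k] [Ring H] [HopfAlgebra k H]

theorem X.mul_apply (x y : X k H) (h : H) : X.mul x y h =
    TensorProduct.lid k k (TensorProduct.map x y (Coalgebra.comul h)) := rfl

theorem X.mul_comm' [Coalgebra.IsCocomm k H] (x y : X k H) : X.mul x y = X.mul y x := by
  ext h
  rw [X.mul_apply, X.mul_apply]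
  conv_lhs => rw [← Coalgebra.comm_comul k h]
  generalize (Coalgebra.comul h : H ⊗[k] H) = z
  induction z using TensorProduct.induction_on with
  | zero => simp only [map_zero]
  | add x y hx hy => simp only [map_add, hx, hy]
  | tmul p q => simp [mul_comm]

theorem X.mul_antipode [Coalgebra.IsCocomm k H] (x y : X k H) (h : H) :
    X.mul x y (HopfAlgebra.antipode k h) =
      TensorProduct.lid k k (TensorProduct.map (X.antip x) (X.antip y) (Coalgebra.comul h)) := by
  have h1 := comul_antipode (k := k) h
  simp only [Bialgebra.comulAlgHom_apply] at h1
  rw [X.mul_apply, h1]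
  generalize (Coalgebra.comul h : H ⊗[k] H) = z
  induction z using TensorProduct.induction_on with
  | zero => simp only [map_zero]
  | add x y hx hy => simp only [map_add, hx, hy]
  | tmul p q => rfl

variable {M : Type*} [AddCommGroup M] [Module k M] [Module H M] [IsScalarTower k H M]

theorem pFourierCoeff_ptmul (x : X k H) (f h : H) (m : M) {n : ℕ} {u v : Fin n → H}
    (hh : Δ₂ k H h = ∑ i, u i ⊗ₜ[k] v i) :
    pFourierCoeff x (ptmul f h m : P₂ k H M) =
      ∑ i, v i • (x (HopfAlgebra.antipode k (f * HopfAlgebra.antipode k (u i))) • m) := by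
  rw [Bialgebra.comulAlgHom_apply] at hh
  simp only [pFourierCoeff, pFourier, ptmul, LinearMap.comp_apply, RelTensor.lift_tmul,
    LinearMap.rTensor_tmul, fourierAux_tmul, hh, map_sum, Finset.mul_sum, TensorProduct.sum_tmul]
  refine Finset.sum_congr rfl fun i _ => ?_
  rw [smul_comm (v i)]
  simp [X.antip]

theorem pFourierCoeff_swap₂_ptmul [Coalgebra.IsCocomm k H] (x : X k H) (f : H) (m : M) :
    pFourierCoeff x (swap₂ M (ptmul f 1 m)) =
      TensorProduct.lid k H ((TensorProduct.map x LinearMap.id) (Δ₂ k H f)) • m := by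
  obtain ⟨n, u, v, hf⟩ := exists_fin_sum_tmul (Δ₂ k H f)
  have h1 : swap₂ M (ptmul f 1 m) = (ptmul 1 f m : P₂ k H M) := rfl
  rw [h1, pFourierCoeff_ptmul x 1 f m hf, hf, map_sum, map_sum, Finset.sum_smul]
  refine Finset.sum_congr rfl fun i _ => ?_
  rw [one_mul, antipode_antipode_of_cocomm, smul_comm]
  simp

/-- The source of conformal skew-symmetry. For z = (f ⊗ 1) ⊗_H m the x_i-coefficient is ⟨x_i, S(f)⟩
m, so the sum is the basis expansion of a linear map evaluated at S(f). -/
theorem isFiniteSum_pFourierCoeff_swap₂ [Coalgebra.IsCocomm k H] {ι : Type*}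
    (e : Module.Basis ι k H) (x : X k H) (z : P₂ k H M) :
    IsFiniteSum (fun i =>
      ((TensorProduct.lid k H) (TensorProduct.map (X.antip x) (HopfAlgebra.antipode k)
        (Δ₂ k H (e i)))) • pFourierCoeff (e.coord i) z) (pFourierCoeff x (swap₂ M z)) := by
  induction z using P₂.induction with
  | h0 =>
    simp only [map_zero, smul_zero]
    exact IsFiniteSum.zero
  | ha z w hz hw =>
    simp only [map_add, smul_add]
    exact hz.add hw
  | ht f m =>
    -- Q(h) = ⟨x, S(h₍₁₎)⟩ S(h₍₂₎) m. At h = S(f), the identities S² = id and ΔS = (S ⊗ S)Δ give ⟨x,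
    -- f₍₁₎⟩ f₍₂₎ m.
    let Q : H →ₗ[k] M := (LinearMap.toSpanSingleton H M m).restrictScalars k ∘ₗ
      (TensorProduct.lid k H).toLinearMap ∘ₗ
        TensorProduct.map (X.antip x) (HopfAlgebra.antipode k) ∘ₗ Coalgebra.comul
    have h1 := isFiniteSum_coord e (HopfAlgebra.antipode k f) Q
    have h2 : Q (HopfAlgebra.antipode k f) = pFourierCoeff x (swap₂ M (ptmul f 1 m)) := by
      rw [pFourierCoeff_swap₂_ptmul]
      have h3 := comul_antipode (k := k) f
      rw [Bialgebra.comulAlgHom_apply] at h3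
      simp only [Q, LinearMap.comp_apply, h3]
      change (_ : H) • m = _
      congr 1
      generalize Δ₂ k H f = w
      induction w using TensorProduct.induction_on with
      | zero => simp only [map_zero]
      | add x y hx hy => simp only [map_add, hx, hy]
      | tmul p q => simp [X.antip, antipode_antipode_of_cocomm]
    rw [h2] at h1
    convert h1 using 2 with i
    rw [pFourierCoeff_ptmul_one, smul_comm]
    rfl

/-- The coefficient `pFourierCoeff x z`, as a bilinear map in `z` and `x`. -/
noncomputable def pFourierCoeffₗ : P₂ k H M →ₗ[k] X k H →ₗ[k] M :=
  LinearMap.mk₂ k (fun z x => pFourierCoeff x z)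
    (fun z w x => map_add _ _ _)
    (fun c z x => map_smul _ _ _)
    (fun z x y => by
      simp only [pFourierCoeff, X.antip, LinearMap.add_comp, LinearMap.rTensor_add,
        LinearMap.comp_apply, LinearMap.add_apply, map_add])
    (fun c z x => by
      simp only [pFourierCoeff, X.antip, LinearMap.smul_comp, LinearMap.rTensor_smul,
        LinearMap.comp_apply, LinearMap.smul_apply, map_smul])

@[simp] theorem pFourierCoeffₗ_apply (z : P₂ k H M) (x : X k H) :
    pFourierCoeffₗ z x = pFourierCoeff x z := rfl

/-- Locality: if z = ∑ (f_i ⊗ 1) ⊗_H m_i is a finite sum, all coefficients lie in the span of the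
m_i, and the codimension of the kernel is the dimension of the range. -/
theorem finite_range_pFourierCoeffₗ (z : P₂ k H M) :
    Module.Finite k (LinearMap.range (pFourierCoeffₗ z)) := by
  induction z using P₂.induction with
  | h0 =>
    rw [map_zero, LinearMap.range_zero]
    infer_instance
  | ha z w hz hw =>
    rw [map_add]
    exact Submodule.finiteDimensional_of_le (LinearMap.range_add_le _ _)
  | ht f m =>
    refine Submodule.finiteDimensional_of_le (S₂ := Submodule.span k {m}) ?_
    rintro _ ⟨x, rfl⟩
    rw [pFourierCoeffₗ_apply, pFourierCoeff_ptmul_one]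
    exact Submodule.smul_mem _ _ (Submodule.mem_span_singleton_self m)

/-- The Fourier transform is injective, and since S is an involution on X, the functionals S(x)
include all coordinate functionals of a basis of H. Hence x-brackets determine the pseudobracket. -/
theorem eq_of_pFourierCoeff [Coalgebra.IsCocomm k H] {z w : P₂ k H M}
    (h : ∀ x : X k H, pFourierCoeff x z = pFourierCoeff x w) : z = w := by
  classical
  apply pFourier_injective
  let b := Module.Basis.ofVectorSpace k H
  refine (TensorProduct.equivFinsuppOfBasisLeft b).injective (Finsupp.ext fun i => ?_)
  have h1 : ∀ t : H ⊗[k] M, TensorProduct.equivFinsuppOfBasisLeft b t i =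
      TensorProduct.lid k M ((b.coord i).rTensor M t) := by
    intro t
    induction t using TensorProduct.induction_on with
    | zero => simp only [map_zero, Finsupp.coe_zero, Pi.zero_apply]
    | add x y hx hy => simp only [map_add, Finsupp.coe_add, Pi.add_apply, hx, hy]
    | tmul p q => simp
  have h2 : X.antip (X.antip (b.coord i)) = b.coord i := by
    ext p
    simp [X.antip, antipode_antipode_of_cocomm]
  rw [h1, h1, ← h2]
  exact h (X.antip (b.coord i))

variable {L : Type*} [AddCommGroup L] [Module k L] [Module H L] [IsScalarTower k H L]

/-- With z = [b * c] this gives [a_x [b_y c]]. The maps `fourierCoeff₃ x y` thus carry the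
pseudo-Jacobi identity to the conformal one, the other two terms being supplied by
`fourierCoeff₃_swap₃` and `isSweedlerSum_compLeft`. -/
theorem fourierCoeff₃_compRight (μ : Pseudoproduct k H L) (x y : X k H) (a : L) (z : P₂ k H L) :
    fourierCoeff₃ x y (μ.compRight a z) = pFourierCoeff x (μ.prod a (pFourierCoeff y z)) := by
  induction z using P₂.induction with
  | h0 => simp only [map_zero]
  | ha z w hz hw => simp only [map_add, hz, hw]
  | ht g d =>
    rw [pFourierCoeff_ptmul_one, map_smul, map_smul]
    have h1 : μ.compRight a (ptmul g 1 d) =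
      ((1 : H) ⊗ₜ[k] (g ⊗ₜ[k] (1 : H))) • expandRight L (μ.prod a d) := rfl
    rw [h1]
    generalize μ.prod a d = w
    induction w using P₂.induction with
    | h0 => simp only [map_zero, smul_zero]
    | ha z w hz hw => simp only [map_add, smul_add, hz, hw]
    | ht f e =>
      have h2 : ((1 : H) ⊗ₜ[k] (g ⊗ₜ[k] (1 : H))) • expandRight L (ptmul f 1 e) =
          RelTensor.tmul (Δ₃ k H) (f ⊗ₜ (g ⊗ₜ 1)) e := by
        rw [expandRight, ptmul, RelTensor.map_tmul, RelTensor.smul_tmul]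
        simp [idΔ, Algebra.TensorProduct.one_def]
      rw [h2, fourierCoeff₃_tmul, pFourierCoeff_ptmul_one, smul_smul, mul_comm]

theorem fourierCoeff₃_swap₃ [Coalgebra.IsCocomm k H] (x y : X k H) (z : P₃ k H L) :
    fourierCoeff₃ x y (swap₃ L z) = fourierCoeff₃ y x z := by
  induction z using P₃.induction with
  | h0 => simp only [map_zero]
  | ha z w hz hw => simp only [map_add, hz, hw]
  | ht f g m =>
    have h1 : swap₃ L (RelTensor.tmul (Δ₃ k H) (f ⊗ₜ (g ⊗ₜ 1)) m) =
      RelTensor.tmul (Δ₃ k H) (g ⊗ₜ (f ⊗ₜ 1)) m := rfl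
    rw [h1, fourierCoeff₃_tmul, fourierCoeff₃_tmul, mul_comm]

/-- If z = (f ⊗ 1) ⊗_H m and m * c = (g ⊗ 1) ⊗_H d, the coefficient is ⟨x, S(f g₍₁₎)⟩ ⟨y, S(g₍₂₎)⟩
d. Since S(f g₍₁₎) = S(g₍₁₎) S(f), splitting x pairs x₍₁₎ with g and x₍₂₎ with f, which explains the
order of the two in the Jacobi identity. -/
theorem isSweedlerSum_compLeft [Coalgebra.IsCocomm k H] {ι : Type*} (e : Module.Basis ι k H)
    (μ : Pseudoproduct k H L) (x y : X k H) (c : L) (z : P₂ k H L) :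
    IsSweedlerSum e x
      (fun x₁ x₂ => pFourierCoeff (X.mul y x₁) (μ.prod (pFourierCoeff x₂ z) c))
      (fourierCoeff₃ x y (μ.compLeft c z)) := by
  induction z using P₂.induction with
  | h0 =>
    simp only [map_zero, LinearMap.zero_apply]
    exact IsSweedlerSum.zero e x
  | ha z w hz hw =>
    simp only [map_add, LinearMap.add_apply]
    exact hz.add hw
  | ht f m =>
    simp only [pFourierCoeff_ptmul_one, map_smul, LinearMap.smul_apply]
    have h1 : μ.compLeft c (ptmul f 1 m) =
      (f ⊗ₜ[k] ((1 : H) ⊗ₜ[k] (1 : H))) • expandLeft L (μ.prod m c) := rfl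
    rw [h1]
    generalize μ.prod m c = w
    induction w using P₂.induction with
    | h0 =>
      simp only [map_zero, smul_zero]
      exact IsSweedlerSum.zero e x
    | ha z w hz hw =>
      simp only [map_add, smul_add]
      exact hz.add hw
    | ht g d =>
      have h2 : (f ⊗ₜ[k] ((1 : H) ⊗ₜ[k] (1 : H))) • expandLeft L (ptmul g 1 d) =
          RelTensor.tmul (Δ₃ k H) ((f ⊗ₜ[k] ((1 : H) ⊗ₜ[k] (1 : H))) *
            Algebra.TensorProduct.assoc k k k H H H (Coalgebra.comul g ⊗ₜ[k] (1 : H))) d := rfl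
      rw [h2]
      -- X is commutative because H is cocommutative; rewriting y x₁ as x₁ y lets x₁ meet g₍₁₎ and y
      -- meet g₍₂₎.
      simp only [pFourierCoeff_ptmul_one, X.mul_comm' y, X.mul_antipode]
      generalize (Coalgebra.comul g : H ⊗[k] H) = w
      induction w using TensorProduct.induction_on with
      | zero =>
        simp only [map_zero, zero_smul, smul_zero, TensorProduct.zero_tmul, mul_zero,
          RelTensor.tmul]
        exact IsSweedlerSum.zero e x
      | add z w hz hw =>
        simp only [map_add, add_smul, smul_add, TensorProduct.add_tmul, mul_add,
          RelTensor.tmul] at hz hw ⊢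
        exact hz.add hw
      | tmul p q =>
        have h3 := isSweedlerSum_tmul e x (HopfAlgebra.antipode k p) (HopfAlgebra.antipode k f)
          (y (HopfAlgebra.antipode k q) • d)
        have h4 : (f ⊗ₜ[k] ((1 : H) ⊗ₜ[k] (1 : H))) *
            Algebra.TensorProduct.assoc k k k H H H ((p ⊗ₜ[k] q) ⊗ₜ[k] (1 : H)) =
            (f * p) ⊗ₜ (q ⊗ₜ 1) := by simp
        rw [h4, fourierCoeff₃_tmul, HopfAlgebra.antipode_mul_antidistrib, mul_smul]
        convert h3 using 3 with x₁ x₂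
        rw [smul_smul, smul_smul]
        congr 1
        simp only [TensorProduct.map_tmul, TensorProduct.lid_tmul, X.antip, LinearMap.comp_apply,
          smul_eq_mul]
        ring

/-- The `x`-brackets of a pseudoproduct, as a trilinear map. -/
noncomputable def Pseudoproduct.xbracketₗ (μ : Pseudoproduct k H L) :
    L →ₗ[k] X k H →ₗ[k] L →ₗ[k] L :=
  LinearMap.lflip.toLinearMap ∘ₗ μ.prod.compr₂ pFourierCoeffₗ

@[simp] theorem Pseudoproduct.xbracketₗ_apply (μ : Pseudoproduct k H L) (a : L) (x : X k H)
    (b : L) : μ.xbracketₗ a x b = pFourierCoeff x (μ.prod a b) := rfl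

theorem Pseudoproduct.IsLie.isLieConformal [Coalgebra.IsCocomm k H] {μ : Pseudoproduct k H L}
    (hμ : μ.IsLie) : IsLieConformal μ.xbracketₗ where
  locality a b := by
    have h1 : (μ.xbracketₗ a).flip b = pFourierCoeffₗ (μ.prod a b) := rfl
    rw [h1]
    have := finite_range_pFourierCoeffₗ (μ.prod a b)
    exact Module.Finite.equiv (pFourierCoeffₗ (μ.prod a b)).quotKerEquivRange.symm
  sesqui_left h a x b := by
    rw [xbracketₗ_apply, xbracketₗ_apply, bilin_left]
    generalize μ.prod a b = z
    induction z using P₂.induction with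
    | h0 => simp only [smul_zero, map_zero]
    | ha z w hz hw => simp only [smul_add, map_add, hz, hw]
    | ht f m =>
      rw [smul_ptmul, one_mul, pFourierCoeff_ptmul_one, pFourierCoeff_ptmul_one,
        HopfAlgebra.antipode_mul_antidistrib]
      rfl
  sesqui_right h a x b n u v hh := by
    simp only [xbracketₗ_apply, bilin_right]
    generalize μ.prod a b = z
    induction z using P₂.induction with
    | h0 => simp only [smul_zero, map_zero, Finset.sum_const_zero]
    | ha z w hz hw => simp only [smul_add, map_add, hz, hw, Finset.sum_add_distrib]
    | ht f m =>
      rw [smul_ptmul, one_mul, mul_one, pFourierCoeff_ptmul x f h m hh]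
      refine Finset.sum_congr rfl fun i _ => ?_
      rw [pFourierCoeff_ptmul_one, HopfAlgebra.antipode_mul_antidistrib]
      rfl
  skew e a x b := by
    have h1 : - μ.xbracketₗ a x b = pFourierCoeff x (swap₂ L (μ.prod b a)) := by
      rw [xbracketₗ_apply, hμ.skew b a, map_neg, neg_neg]
    rw [h1]
    exact isFiniteSum_pFourierCoeff_swap₂ e x (μ.prod b a)
  jacobi e a b c x y := by
    simp only [xbracketₗ_apply]
    rw [← fourierCoeff₃_compRight, ← fourierCoeff₃_compRight, ← fourierCoeff₃_swap₃ x y, ← map_sub,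
      hμ.jacobi]
    exact isSweedlerSum_compLeft e μ x y c (μ.prod a b)

end Conformal

/-! ### The brackets on the pseudo-dual and their uniqueness -/

section DualBracket

variable {k : Type*} {H : Type v} [Field k] [Ring H] [HopfAlgebra k H] [Coalgebra.IsCocomm k H]
  {R : Type*} [AddCommGroup R] [Module k R] [Module H R] [IsScalarTower k H R]

open PDual

omit [IsScalarTower k H R] in
theorem PDual.eq_of_coeff {f g : PDual k H R} (h : ∀ (y : X k H) r, f.coeff y r = g.coeff y r) :
    f = g := by
  refine eq_of_fnAt fun r => ?_
  rw [← antipode_antipode_of_cocomm (k := k) (fnAt r f),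
    ← antipode_antipode_of_cocomm (k := k) (fnAt r g)]
  congr 1
  have := Module.forall_dual_apply_eq_zero_iff k
    (HopfAlgebra.antipode k (fnAt r f) - HopfAlgebra.antipode k (fnAt r g))
  refine sub_eq_zero.1 (this.1 fun y => ?_)
  have h1 := h y r
  rw [coeff_eq, coeff_eq] at h1
  rw [map_sub]
  exact sub_eq_zero.2 h1

-- One basis of H and one expression of δ(r) already fix every Fourier coefficient of the bracket,
-- and these determine an element of R^*.
omit [IsScalarTower k H R] in
theorem IsDualBracket.unique {δ : R →ₗ[k] R ⊗[k] R}
    {br br' : PDual k H R →ₗ[k] X k H →ₗ[k] PDual k H R →ₗ[k] PDual k H R}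
    (h : IsDualBracket δ br) (h' : IsDualBracket δ br') : br = br' := by
  ext f x g : 3
  refine eq_of_coeff fun y r => ?_
  obtain ⟨n, u, v, hr⟩ := exists_fin_sum_tmul (δ r)
  have h1 := (h (Module.Basis.ofVectorSpace k H) f g x y r n u v hr).2
  have h2 := (h' (Module.Basis.ofVectorSpace k H) f g x y r n u v hr).2
  exact h1.symm.trans h2

/-- The bracket formula for a single tensor p ⊗ q = f(r₍₁₎) ⊗ g(r₍₂₎). The coefficient is ⟨x, S(p
S(q₍₁₎))⟩ ⟨y, S(q₍₂₎)⟩, and S(p S(q₍₁₎)) = S²(q₍₁₎) S(p) splits x so that x₍₂₎ meets p and S(x₍₁₎)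
meets S(q₍₁₎). -/
theorem isSweedlerSum_fourierAux {ι : Type*} (e : Module.Basis ι k H) (x y : X k H) (p q : H) :
    IsSweedlerSum e x (fun x₁ x₂ => x₂ (HopfAlgebra.antipode k p) *
        X.mul y (X.antip x₁) (HopfAlgebra.antipode k q))
      (y (HopfAlgebra.antipode k (TensorProduct.lid k H
        ((X.antip x).rTensor H (fourierAux (p ⊗ₜ[k] q)))))) := by
  simp only [X.mul_comm' y, X.mul_antipode, fourierAux_tmul]
  generalize (Coalgebra.comul q : H ⊗[k] H) = w
  induction w using TensorProduct.induction_on with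
  | zero =>
    simp only [map_zero, mul_zero]
    exact IsSweedlerSum.zero e x
  | add z w hz hw =>
    simp only [map_add, mul_add]
    exact hz.add hw
  | tmul q₁ q₂ =>
    have h3 := isSweedlerSum_tmul e x
      (HopfAlgebra.antipode k (HopfAlgebra.antipode k q₁)) (HopfAlgebra.antipode k p)
      (y (HopfAlgebra.antipode k q₂))
    convert h3 using 3 with x₁ x₂
    · simp only [TensorProduct.map_tmul, TensorProduct.lid_tmul, X.antip, LinearMap.comp_apply,
        smul_eq_mul]
      ring
    · simp [X.antip, HopfAlgebra.antipode_mul_antidistrib]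

theorem isDualBracket_xbracketₗ [Module.Finite H R] (δ : R →ₗ[k] R ⊗[k] R)
    (hδ : ∀ (h : H) (r : R), δ (h • r) = diagAct h (δ r)) :
    IsDualBracket δ (dualPseudoproduct δ hδ).xbracketₗ := by
  intro ι e f g x y r n u v hr
  rw [coeff_eq, ← fnAt_apply, Pseudoproduct.xbracketₗ_apply, fnAt_pFourierCoeff,
    evAt_dualPseudoproduct, hr]
  simp only [map_sum, coeff_eq]
  exact IsSweedlerSum.sum _ fun s => isSweedlerSum_fourierAux e x y (fn f (u s)) (fn g (v s))

theorem dual_of_isLieCoalgebra [Module.Finite H R] (δ : R →ₗ[k] R ⊗[k] R)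
    (hδ : IsLieCoalgebra (H := H) δ) :
    (∃! br : PDual k H R →ₗ[k] X k H →ₗ[k] PDual k H R →ₗ[k] PDual k H R,
        IsDualBracket δ br) ∧
      ∀ br : PDual k H R →ₗ[k] X k H →ₗ[k] PDual k H R →ₗ[k] PDual k H R,
        IsDualBracket δ br →
          IsLieConformal br ∧
          ∃! μ : Pseudoproduct k H (PDual k H R),
            μ.IsLie ∧ ∀ f x g, μ.xbracket f x g = br f x g := by
  have h1 : IsDualBracket δ (dualPseudoproduct δ hδ.map_act).xbracketₗ :=
    isDualBracket_xbracketₗ δ hδ.map_act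
  have hL := isLie_dualPseudoproduct δ hδ
  refine ⟨⟨_, h1, fun br hbr => hbr.unique h1⟩, fun br hbr => ?_⟩
  obtain rfl := hbr.unique h1
  refine ⟨hL.isLieConformal, _, ⟨hL, fun f x g => rfl⟩, ?_⟩
  rintro ⟨prod, bilin⟩ ⟨-, hν⟩
  have h2 : prod = (dualPseudoproduct δ hδ.map_act).prod :=
    LinearMap.ext₂ fun f g => eq_of_pFourierCoeff fun x => hν f x g
  subst h2
  rfl

end DualBracket

/-! ### The pairing of A ⊗_H L with L^* -/

section Pairing

variable {k H : Type*} [Field k] [Ring H] [HopfAlgebra k H]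
  {L : Type*} [AddCommGroup L] [Module k L] [Module H L]

namespace PDual

theorem fnAt_add (u v : L) : fnAt (k := k) (H := H) (u + v) = fnAt u + fnAt v := by
  ext φ
  exact map_add (fn φ) u v

theorem fnAt_zero : fnAt (k := k) (H := H) (0 : L) = 0 := by
  ext φ
  exact map_zero (fn φ)

section

variable {A : Type*} [Ring A] [Algebra k A] {Δ : H →ₐ[k] A} (S : A →ₗ[k] A)
  (hS : ∀ a b, S (a * b) = S b * S a)
  (hΔ : ∀ h, Δ (HopfAlgebra.antipode k h) = S (Δ h))

/-- The pairing of `A ⊗_H L` with `L^*`: `⟨a ⊗_H m, φ⟩ = Δ(φ(m)) S(a)`, for an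
anti-endomorphism `S` of `A` compatible with the antipode of `H`. -/
noncomputable def pairing : RelTensor Δ L →ₗ[k] PDual k H L →ₗ[k] A :=
  RelTensor.lift (TensorProduct.lift (LinearMap.mk₂ k
    (fun a m => LinearMap.mulRight k (S a) ∘ₗ Δ.toLinearMap ∘ₗ fnAt m)
    (fun a a' m => by
      ext φ
      simp [mul_add])
    (fun c a m => by
      ext φ
      simp)
    (fun a m m' => by
      ext φ
      simp [add_mul])
    (fun c a m => by
      ext φ
      simp))) <| by
    intro a h m
    ext φ
    -- Balancedness: Δ(φ(m)) S(a Δ(h)) = Δ(φ(m)) Δ(S(h)) S(a) = Δ(φ(hm)) S(a).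
    simp [hS, ← hΔ, fn_apply_smul, mul_assoc]

@[simp] theorem pairing_tmul (a : A) (m : L) (φ : PDual k H L) :
    pairing S hS hΔ (RelTensor.tmul Δ a m) φ = Δ (fn φ m) * S a := by
  simp [pairing]

theorem pairing_smul_right (h : H) (z : RelTensor Δ L) (φ : PDual k H L) :
    pairing S hS hΔ z (h • φ) = Δ h * pairing S hS hΔ z φ := by
  induction z using RelTensor.induction with
  | h0 => simp only [map_zero, LinearMap.zero_apply, mul_zero]
  | ha x y hx hy => simp only [map_add, LinearMap.add_apply, mul_add, hx, hy]
  | ht a m => rw [pairing_tmul, pairing_tmul, fn_smul, map_mul, mul_assoc]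

theorem pairing_smul_left (a : A) (z : RelTensor Δ L) (φ : PDual k H L) :
    pairing S hS hΔ (a • z) φ = pairing S hS hΔ z φ * S a := by
  induction z using RelTensor.induction with
  | h0 => simp only [smul_zero, map_zero, LinearMap.zero_apply, zero_mul]
  | ha x y hx hy => simp only [smul_add, map_add, LinearMap.add_apply, add_mul, hx, hy]
  | ht b m => rw [RelTensor.smul_tmul, pairing_tmul, pairing_tmul, hS, mul_assoc]

variable {B : Type*} [Ring B] [Algebra k B] {Δ' : H →ₐ[k] B} (T : B →ₗ[k] B)
  (hT : ∀ a b, T (a * b) = T b * T a)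
  (hΔ' : ∀ h, Δ' (HopfAlgebra.antipode k h) = T (Δ' h))

/-- The common source of the compatibility of the pairing with the permutations and with the
expansions `expandRight` and `expandLeft`; in each case only commutation of F with the antipodes
remains to be known. -/
theorem pairing_map (F : A →ₐ[k] B) (hF : ∀ h, F (Δ h) = Δ' h) (hST : ∀ a, F (S a) = T (F a))
    (z : RelTensor Δ L) (φ : PDual k H L) :
    pairing T hT hΔ' (RelTensor.map F hF L z) φ = F (pairing S hS hΔ z φ) := by
  induction z using RelTensor.induction with
  | h0 => simp only [map_zero, LinearMap.zero_apply]
  | ha x y hx hy => simp only [map_add, LinearMap.add_apply, hx, hy]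
  | ht b m => rw [RelTensor.map_tmul, pairing_tmul, pairing_tmul, map_mul, hF, hST]

end

theorem map_fnAt_outerAct (u v : L) (w : H ⊗[k] H) (z : PDual k H L ⊗[k] PDual k H L) :
    TensorProduct.map (fnAt u) (fnAt v) (outerAct w z) =
      w * TensorProduct.map (fnAt u) (fnAt v) z := by
  induction w using TensorProduct.induction_on with
  | zero => simp only [map_zero, zero_mul, LinearMap.zero_apply]
  | add x y hx hy => simp only [map_add, LinearMap.add_apply, add_mul, hx, hy]
  | tmul p q =>
    induction z using TensorProduct.induction_on with
    | zero => simp only [map_zero, mul_zero]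
    | add x y hx hy => simp only [map_add, mul_add, hx, hy]
    | tmul m n => simp [fn_smul]

theorem map_fnAt_smul_left (g : H) (u v : L) (z : PDual k H L ⊗[k] PDual k H L) :
    TensorProduct.map (fnAt (g • u)) (fnAt v) z =
      TensorProduct.map (fnAt u) (fnAt v) z * antipode₂ k H (g ⊗ₜ 1) := by
  induction z using TensorProduct.induction_on with
  | zero => simp only [map_zero, zero_mul]
  | add x y hx hy => simp only [map_add, add_mul, hx, hy]
  | tmul m n => simp [fn_apply_smul]

theorem map_fnAt_smul_right (g : H) (u v : L) (z : PDual k H L ⊗[k] PDual k H L) :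
    TensorProduct.map (fnAt u) (fnAt (g • v)) z =
      TensorProduct.map (fnAt u) (fnAt v) z * antipode₂ k H (1 ⊗ₜ g) := by
  induction z using TensorProduct.induction_on with
  | zero => simp only [map_zero, zero_mul]
  | add x y hx hy => simp only [map_add, add_mul, hx, hy]
  | tmul m n => simp [fn_apply_smul]

variable [Coalgebra.IsCocomm k H]

/-- The pairing of `H^{⊗2} ⊗_H L` with `L^*`. -/
noncomputable def pairing₂ : P₂ k H L →ₗ[k] PDual k H L →ₗ[k] H ⊗[k] H :=
  pairing (antipode₂ k H) antipode₂_mul comul_antipode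

/-- The pairing of `H^{⊗3} ⊗_H L` with `L^*`. -/
noncomputable def pairing₃ : P₃ k H L →ₗ[k] PDual k H L →ₗ[k] H ⊗[k] (H ⊗[k] H) :=
  pairing (antipode₃ k H) antipode₃_mul Δ₃_antipode

theorem pairing₂_tmul (a : H ⊗[k] H) (m : L) (φ : PDual k H L) :
    pairing₂ (RelTensor.tmul (Δ₂ k H) a m) φ = Δ₂ k H (fn φ m) * antipode₂ k H a :=
  pairing_tmul _ _ _ a m φ

theorem pairing₂_swap₂ (z : P₂ k H L) (φ : PDual k H L) :
    pairing₂ (swap₂ L z) φ = Algebra.TensorProduct.comm k H H (pairing₂ z φ) :=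
  pairing_map _ _ _ _ _ _ _ _ (fun a => (antipode₂_comm a).symm) z φ

theorem pairing₃_swap₃ (z : P₃ k H L) (φ : PDual k H L) :
    pairing₃ (swap₃ L z) φ = Algebra.TensorProduct.leftComm k H H H (pairing₃ z φ) :=
  pairing_map _ _ _ _ _ _ _ _ (fun a => (antipode₃_leftComm a).symm) z φ

theorem pairing₃_expandRight (z : P₂ k H L) (φ : PDual k H L) :
    pairing₃ (expandRight L z) φ = idΔ k H (pairing₂ z φ) :=
  pairing_map _ _ _ _ _ _ _ _ idΔ_antipode₂ z φ

theorem pairing₃_expandLeft (z : P₂ k H L) (φ : PDual k H L) :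
    pairing₃ (expandLeft L z) φ = Δid k H (pairing₂ z φ) :=
  pairing_map _ _ _ _ _ _ _ _ Δid_antipode₂ z φ

theorem pairing₃_smul (a : H ⊗[k] (H ⊗[k] H)) (z : P₃ k H L) (φ : PDual k H L) :
    pairing₃ (a • z) φ = pairing₃ z φ * antipode₃ k H a :=
  pairing_smul_left _ _ _ a z φ

end PDual

end Pairing

/-! ### The co-Jacobi expression under a tensor product of maps -/

section TensorMaps

variable {k D E : Type*} [Field k] [AddCommGroup D] [Module k D] [AddCommGroup E] [Module k E]

theorem map_sub_leftComm (f g e : D →ₗ[k] E) (t : D ⊗[k] (D ⊗[k] D)) :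
    TensorProduct.map f (TensorProduct.map g e) (t - TensorProduct.leftComm k D D D t) =
      TensorProduct.map f (TensorProduct.map g e) t -
        TensorProduct.leftComm k E E E (TensorProduct.map g (TensorProduct.map f e) t) := by
  rw [map_sub, map_leftComm]

end TensorMaps

/-! ### Transposing the Lie axioms to the pseudo-dual -/

section DualCobracket

variable {k H : Type*} [Field k] [Ring H] [HopfAlgebra k H] [Coalgebra.IsCocomm k H]
  {L : Type*} [AddCommGroup L] [Module k L] [Module H L]

open PDual

/-- `δ : L^* → L^* ⊗ L^*` is dual to the pseudoproduct `μ`. -/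
def IsDualTo (μ : Pseudoproduct k H L) (δ : PDual k H L →ₗ[k] PDual k H L ⊗[k] PDual k H L) :
    Prop :=
  ∀ φ u v, TensorProduct.map (fnAt u) (fnAt v) (δ φ) = pairing₂ (μ.prod u v) φ

variable {μ : Pseudoproduct k H L} {δ : PDual k H L →ₗ[k] PDual k H L ⊗[k] PDual k H L}

/-- For z = a ⊗_H m and a summand ψ ⊗ χ of δ(φ), both sides contribute ψ(u) ⊗ Δ(χ(m)) (S ⊗ S)(a).
Taking z = [v * w] makes (id ⊗ δ)δ the transpose of [u * [v * w]]. -/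
theorem IsDualTo.map_compRight (h : IsDualTo μ δ) (u : L) (z : P₂ k H L) (φ : PDual k H L) :
    TensorProduct.map (fnAt u) (pairing₂ z) (δ φ) = pairing₃ (μ.compRight u z) φ := by
  induction z using RelTensor.induction with
  | h0 => simp only [map_zero, TensorProduct.map_zero_right, LinearMap.zero_apply]
  | ha x y hx hy => simp only [map_add, TensorProduct.map_add_right, LinearMap.add_apply, hx, hy]
  | ht a m =>
    have h1 : μ.compRight u (RelTensor.tmul (Δ₂ k H) a m) =
      ((1 : H) ⊗ₜ[k] a) • expandRight L (μ.prod u m) := rfl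
    rw [h1, pairing₃_smul, pairing₃_expandRight, ← h]
    generalize δ φ = t
    induction t using TensorProduct.induction_on with
    | zero => simp only [map_zero, zero_mul]
    | add x y hx hy => simp only [map_add, add_mul, hx, hy]
    | tmul ψ χ => simp [pairing₂_tmul, idΔ]

theorem IsDualTo.map_compLeft (h : IsDualTo μ δ) (w : L) (z : P₂ k H L) (φ : PDual k H L) :
    Algebra.TensorProduct.assoc k k k H H H
      (TensorProduct.map (pairing₂ z) (fnAt w) (δ φ)) = pairing₃ (μ.compLeft w z) φ := by
  induction z using RelTensor.induction with
  | h0 => simp only [map_zero, TensorProduct.map_zero_left, LinearMap.zero_apply]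
  | ha x y hx hy => simp only [map_add, TensorProduct.map_add_left, LinearMap.add_apply, hx, hy]
  | ht a m =>
    have h1 : μ.compLeft w (RelTensor.tmul (Δ₂ k H) a m) =
      (Algebra.TensorProduct.assoc k k k H H H (a ⊗ₜ[k] (1 : H))) •
        expandLeft L (μ.prod m w) := rfl
    rw [h1, pairing₃_smul, pairing₃_expandLeft, ← h, antipode₃_assoc, HopfAlgebra.antipode_one]
    generalize δ φ = t
    induction t using TensorProduct.induction_on with
    | zero => simp only [map_zero, zero_mul]
    | add x y hx hy => simp only [map_add, add_mul, hx, hy]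
    | tmul ψ χ =>
      have h2 : Δid k H (TensorProduct.map (fnAt m) (fnAt w) (ψ ⊗ₜ[k] χ)) =
        Algebra.TensorProduct.assoc k k k H H H (Δ₂ k H (fn ψ m) ⊗ₜ[k] fn χ w) := rfl
      rw [h2, ← map_mul, Algebra.TensorProduct.tmul_mul_tmul, mul_one, TensorProduct.map_tmul,
        pairing₂_tmul]
      rfl

theorem IsDualTo.map_lTensor (h : IsDualTo μ δ) (u v w : L) (φ : PDual k H L) :
    TensorProduct.map (fnAt u) (TensorProduct.map (fnAt v) (fnAt w)) (δ.lTensor _ (δ φ)) =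
      pairing₃ (μ.compRight u (μ.prod v w)) φ := by
  have h1 : TensorProduct.map (fnAt v) (fnAt w) ∘ₗ δ = pairing₂ (μ.prod v w) :=
    LinearMap.ext fun φ => h φ v w
  rw [← LinearMap.comp_apply, LinearMap.map_comp_lTensor, h1, h.map_compRight]

theorem IsDualTo.map_rTensor (h : IsDualTo μ δ) (u v w : L) (φ : PDual k H L) :
    TensorProduct.map (fnAt u) (TensorProduct.map (fnAt v) (fnAt w))
      (TensorProduct.assoc k _ _ _ (δ.rTensor _ (δ φ))) =
      pairing₃ (μ.compLeft w (μ.prod u v)) φ := by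
  have h1 : TensorProduct.map (fnAt u) (fnAt v) ∘ₗ δ = pairing₂ (μ.prod u v) :=
    LinearMap.ext fun φ => h φ u v
  rw [map_assoc, ← LinearMap.comp_apply, LinearMap.map_comp_rTensor, h1]
  exact h.map_compLeft w (μ.prod u v) φ

theorem IsDualTo.comm_eq_neg (h : IsDualTo μ δ) (hμ : μ.IsLie) (φ : PDual k H L) :
    TensorProduct.comm k _ _ (δ φ) = - δ φ := by
  refine eq_of_map_fnAt fun u v => ?_
  rw [map_comm]
  refine Eq.trans ?_ (map_neg (TensorProduct.map (fnAt u) (fnAt v)) (δ φ)).symm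
  rw [h, h, hμ.skew v u, map_neg, LinearMap.neg_apply, neg_neg, pairing₂_swap₂]
  rfl

/-- Tensors in three copies of L^* are separated by evaluation at triples (u, v, w), and there the
identity is the Jacobi identity of u, v, w paired with φ. -/
theorem IsDualTo.coJacobi (h : IsDualTo μ δ) (hμ : μ.IsLie) (φ : PDual k H L) :
    δ.lTensor _ (δ φ) - TensorProduct.leftComm k _ _ _ (δ.lTensor _ (δ φ)) =
      TensorProduct.assoc k _ _ _ (δ.rTensor _ (δ φ)) := by
  refine eq_of_map_fnAt₃ fun u v w => ?_
  rw [h.map_rTensor, ← hμ.jacobi, map_sub (pairing₃ (k := k) (H := H) (L := L)),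
    LinearMap.sub_apply, pairing₃_swap₃,
    ← h.map_lTensor, ← h.map_lTensor]
  exact map_sub_leftComm (fnAt (k := k) (H := H) u) (fnAt (k := k) (H := H) v)
    (fnAt (k := k) (H := H) w) (δ.lTensor _ (δ φ))

theorem IsDualTo.isLieCoalgebra (h : IsDualTo μ δ) (hμ : μ.IsLie)
    (hδ : ∀ (g : H) (φ : PDual k H L), δ (g • φ) = diagAct g (δ φ)) :
    IsLieCoalgebra (H := H) δ :=
  ⟨hδ, h.comm_eq_neg hμ, h.coJacobi hμ⟩

end DualCobracket

/-! ### The dual basis and the cobracket of a free pseudoalgebra -/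

section DualBasis

variable {k H : Type*} [Field k] [Ring H] [HopfAlgebra k H]

theorem outerAct_mul {M N : Type*} [AddCommGroup M] [Module k M] [Module H M]
    [IsScalarTower k H M] [AddCommGroup N] [Module k N] [Module H N] [IsScalarTower k H N]
    (w z : H ⊗[k] H) (t : M ⊗[k] N) : outerAct (w * z) t = outerAct w (outerAct z t) := by
  induction t using TensorProduct.induction_on with
  | zero => simp only [map_zero]
  | add x y hx hy => simp only [map_add, hx, hy]
  | tmul m n =>
    induction w using TensorProduct.induction_on with
    | zero => simp only [zero_mul, map_zero, LinearMap.zero_apply]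
    | add x y hx hy => simp only [add_mul, map_add, LinearMap.add_apply, hx, hy]
    | tmul p q =>
      induction z using TensorProduct.induction_on with
      | zero => simp only [mul_zero, map_zero, LinearMap.zero_apply]
      | add x y hx hy => simp only [mul_add, map_add, LinearMap.add_apply, hx, hy]
      | tmul r s => simp [mul_smul]

theorem outerAct_one {M N : Type*} [AddCommGroup M] [Module k M] [Module H M]
    [IsScalarTower k H M] [AddCommGroup N] [Module k N] [Module H N] [IsScalarTower k H N]
    (t : M ⊗[k] N) : outerAct (1 : H ⊗[k] H) t = t := by
  induction t using TensorProduct.induction_on with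
  | zero => simp only [map_zero]
  | add x y hx hy => simp only [map_add, hx, hy]
  | tmul m n => simp [Algebra.TensorProduct.one_def]

section

variable {D : Type*} [AddCommGroup D] [Module k D] [Module H D] [IsScalarTower k H D]
  {N m : ℕ} (a' : Module.Basis (Fin N) H D) (h l : Fin N → Fin N → Fin N → Fin m → H)

theorem IsDualCobracket.unique {δ δ' : D →ₗ[k] D ⊗[k] D} (hδ : IsDualCobracket a' h l δ)
    (hδ' : IsDualCobracket a' h l δ') : δ = δ' := by
  ext φ
  have hφ : φ ∈ Submodule.span H (Set.range a') := a'.span_eq ▸ Submodule.mem_top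
  induction hφ using Submodule.span_induction with
  | mem x hx =>
    obtain ⟨p, rfl⟩ := hx
    rw [hδ.2, hδ'.2]
  | zero => rw [map_zero, map_zero]
  | add x y _ _ hx hy => rw [map_add, map_add, hx, hy]
  | smul g x _ hx => rw [hδ.1, hδ'.1, hx]

theorem exists_isDualCobracket : ∃ δ : D →ₗ[k] D ⊗[k] D, IsDualCobracket a' h l δ := by
  classical
  let T : Fin N → D ⊗[k] D := fun p => ∑ i, ∑ j, ∑ q,
    (HopfAlgebra.antipode k (h i j p q) • a' i) ⊗ₜ[k] (HopfAlgebra.antipode k (l i j p q) • a' j)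
  -- The H-linear extension: ∑ h_p a^p is sent to ∑ Δ(h_p) T_p.
  refine ⟨∑ p, (outerAct (k := k) (H := H)).flip (T p) ∘ₗ (Δ₂ k H).toLinearMap ∘ₗ
    (a'.coord p).restrictScalars k, fun g φ => ?_, fun p => ?_⟩
  · rw [LinearMap.sum_apply, LinearMap.sum_apply, map_sum]
    refine Finset.sum_congr rfl fun p _ => ?_
    simp only [LinearMap.comp_apply, LinearMap.flip_apply, LinearMap.restrictScalars_apply,
      map_smul, smul_eq_mul, AlgHom.toLinearMap_apply, diagAct]
    rw [map_mul, outerAct_mul]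
  · rw [LinearMap.sum_apply, Finset.sum_eq_single p]
    · simp only [LinearMap.comp_apply, LinearMap.flip_apply, LinearMap.restrictScalars_apply,
        AlgHom.toLinearMap_apply, Module.Basis.coord_apply, Module.Basis.repr_self,
        Finsupp.single_eq_same]
      rw [map_one, outerAct_one]
    · intro q _ hq
      simp [Ne.symm hq]
    · exact fun hp => absurd (Finset.mem_univ p) hp

end

variable {L : Type*} [AddCommGroup L] [Module k L] [Module H L] [IsScalarTower k H L]

namespace PDual

variable {ι : Type*} (a : Module.Basis ι H L)

/-- The element of `L^*` dual to the `i`-th member of a basis of `L`. -/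
noncomputable def dualElt (i : ι) : PDual k H L :=
  -- The coordinate is left H-linear; composing with S gives the rule F(hv) = F(v) S(h).
  ofFn (HopfAlgebra.antipode k ∘ₗ (a.coord i).restrictScalars k) fun h v => by
    simp [HopfAlgebra.antipode_mul_antidistrib]

theorem fn_dualElt (i : ι) (v : L) :
    fn (dualElt (k := k) a i) v = HopfAlgebra.antipode k (a.coord i v) := by
  rw [dualElt, fn_ofFn]
  rfl

omit [IsScalarTower k H L] in
theorem fn_ext_basis {φ ψ : PDual k H L} (h : ∀ j, fn φ (a j) = fn ψ (a j)) : φ = ψ := by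
  refine eq_of_fnAt fun v => ?_
  rw [fnAt_apply, fnAt_apply]
  have hv : v ∈ Submodule.span H (Set.range a) := a.span_eq ▸ Submodule.mem_top
  induction hv using Submodule.span_induction with
  | mem x hx =>
    obtain ⟨p, rfl⟩ := hx
    exact h p
  | zero => rw [map_zero, map_zero]
  | add x y _ _ hx hy => rw [map_add, map_add, hx, hy]
  | smul g x _ hx => rw [fn_apply_smul, fn_apply_smul, hx]

variable [DecidableEq ι]

theorem fn_dualElt_basis (i j : ι) :
    fn (dualElt (k := k) a i) (a j) = if i = j then 1 else 0 := by
  rw [fn_dualElt, Module.Basis.coord_apply, Module.Basis.repr_self, Finsupp.single_apply]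
  split_ifs with h1 h2 h2
  · exact HopfAlgebra.antipode_one
  · exact absurd h1.symm h2
  · exact absurd h2.symm h1
  · exact map_zero _

variable [Fintype ι]

theorem fn_sum_smul_dualElt (c : ι → H) (j : ι) :
    fn (∑ i, c i • dualElt (k := k) a i) (a j) = c j := by
  rw [map_sum, LinearMap.sum_apply]
  simp [fn_smul, fn_dualElt_basis]

/-- The basis of `L^*` dual to a finite basis of `L`. -/
noncomputable def dualBasis : Module.Basis ι H (PDual k H L) :=
  Module.Basis.ofEquivFun
    { toFun := fun φ i => fn φ (a i)
      map_add' := fun φ ψ => by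
        ext i
        simp
      map_smul' := fun h φ => by
        ext i
        simp [fn_smul]
      invFun := fun c => ∑ i, c i • dualElt a i
      left_inv := fun φ => fn_ext_basis a fun j => fn_sum_smul_dualElt a _ j
      right_inv := fun c => funext fun j => fn_sum_smul_dualElt a c j }

theorem dualBasis_apply (i : ι) : dualBasis (k := k) a i = dualElt a i := by
  rw [dualBasis, Module.Basis.coe_ofEquivFun]
  change ∑ j, Function.update (0 : ι → H) i 1 j • dualElt a j = _
  rw [Finset.sum_eq_single i]
  · simp
  · intro j _ hj
    simp [Function.update_of_ne hj]
  · exact fun hi => absurd (Finset.mem_univ i) hi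

omit [Fintype ι] in
theorem dualElt_apply_basis (i j : ι) :
    (dualElt (k := k) a i).1 (a j) = ptmul 1 1 (Triv.of k H (if i = j then 1 else 0)) := by
  apply trivEval_injective
  rw [← fn_apply, fn_dualElt_basis, trivEval_ptmul]
  split_ifs <;> simp [Triv.of, Triv.val]

end PDual

open PDual

/-- Both sides of the duality are multiplied on the left by Δ(g) when φ becomes gφ, and on the right
by S(g) ⊗ 1 or 1 ⊗ S(g) when u or v is multiplied by g. It therefore suffices to take basis elements
a^p, a_i, a_j, where both sides equal ∑_q S(h^{ij}_p) ⊗ S(l^{ij}_p). -/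
theorem IsDualCobracket.isDualTo [Coalgebra.IsCocomm k H] {μ : Pseudoproduct k H L} {N m : ℕ}
    (a : Module.Basis (Fin N) H L) {h l : Fin N → Fin N → Fin N → Fin m → H}
    (hμ : ∀ i j, μ.prod (a i) (a j) = ∑ p, ∑ q, ptmul (h i j p q) (l i j p q) (a p))
    {δ : PDual k H L →ₗ[k] PDual k H L ⊗[k] PDual k H L}
    (hδ : IsDualCobracket (dualBasis (k := k) a) h l δ) : IsDualTo μ δ := by
  intro φ u v
  have hφ : φ ∈ Submodule.span H (Set.range (dualBasis (k := k) a)) :=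
    (dualBasis (k := k) a).span_eq ▸ Submodule.mem_top
  have hu : u ∈ Submodule.span H (Set.range a) := a.span_eq ▸ Submodule.mem_top
  have hv : v ∈ Submodule.span H (Set.range a) := a.span_eq ▸ Submodule.mem_top
  induction hφ using Submodule.span_induction with
  | zero => simp only [map_zero]
  | add x y _ _ hx hy => simp only [map_add, hx, hy]
  | smul g x _ hx =>
    rw [hδ.1, diagAct, map_fnAt_outerAct, hx, pairing₂, pairing_smul_right]
  | mem x hx =>
    obtain ⟨p, rfl⟩ := hx
    induction hu using Submodule.span_induction with
    | zero =>
      simp only [fnAt_zero, TensorProduct.map_zero_left, map_zero, LinearMap.zero_apply]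
    | add x y _ _ hx hy =>
      simp only [fnAt_add, TensorProduct.map_add_left, map_add, LinearMap.add_apply, hx, hy]
    | smul g x _ hx =>
      rw [map_fnAt_smul_left, hx, μ.bilin_left, pairing₂, pairing_smul_left]
    | mem x hx =>
      obtain ⟨i, rfl⟩ := hx
      induction hv using Submodule.span_induction with
      | zero =>
        simp only [fnAt_zero, TensorProduct.map_zero_right, map_zero, LinearMap.zero_apply]
      | add x y _ _ hx hy =>
        simp only [fnAt_add, TensorProduct.map_add_right, map_add, LinearMap.add_apply, hx, hy]
      | smul g x _ hx =>
        rw [map_fnAt_smul_right, hx, μ.bilin_right, pairing₂, pairing_smul_left]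
      | mem x hx =>
        obtain ⟨j, rfl⟩ := hx
        rw [hδ.2, hμ]
        simp only [map_sum, LinearMap.sum_apply, TensorProduct.map_tmul, fnAt_apply, fn_smul,
          dualBasis_apply, fn_dualElt_basis, ptmul, pairing₂_tmul]
        rw [Finset.sum_eq_single i, Finset.sum_eq_single j, Finset.sum_eq_single p]
        · simp
        · intro p' _ hp
          simp [Ne.symm hp]
        · exact fun hp => absurd (Finset.mem_univ _) hp
        · intro j' _ hj
          simp [hj]
        · exact fun hj => absurd (Finset.mem_univ _) hj
        · intro i' _ hi
          simp [hi]
        · exact fun hi => absurd (Finset.mem_univ _) hi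

theorem dual_of_isLie [Coalgebra.IsCocomm k H] (μ : Pseudoproduct k H L) (hμ : μ.IsLie) (N : ℕ)
    (a : Module.Basis (Fin N) H L) (m : ℕ) (h l : Fin N → Fin N → Fin N → Fin m → H)
    (hhl : ∀ i j, μ.prod (a i) (a j) = ∑ p, ∑ q, ptmul (h i j p q) (l i j p q) (a p)) :
    ∃ a' : Module.Basis (Fin N) H (PDual k H L),
      (∀ i j, (a' i).1 (a j) = ptmul 1 1 (Triv.of k H (if i = j then 1 else 0))) ∧
      (∃! δ : PDual k H L →ₗ[k] PDual k H L ⊗[k] PDual k H L, IsDualCobracket a' h l δ) ∧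
      ∀ δ : PDual k H L →ₗ[k] PDual k H L ⊗[k] PDual k H L,
        IsDualCobracket a' h l δ → IsLieCoalgebra (H := H) δ := by
  obtain ⟨δ, hδ⟩ := exists_isDualCobracket (k := k) (dualBasis (k := k) a) h l
  refine ⟨dualBasis (k := k) a, fun i j => ?_, ⟨δ, hδ, fun δ' hδ' => hδ'.unique _ _ _ hδ⟩,
    fun δ' hδ' => ?_⟩
  · rw [dualBasis_apply, dualElt_apply_basis]
  · exact (hδ'.isDualTo a hhl).isLieCoalgebra hμ hδ'.1

end DualBasis

end HPseudo

theorem mainTheorem1 {k : Type*} {H : Type*} [Field k] [IsAlgClosed k] [CharZero k] [Ring H]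
    [HopfAlgebra k H] [Coalgebra.IsCocomm k H] :
    (∀ {L : Type*} [AddCommGroup L] [Module k L] [Module H L] [IsScalarTower k H L]
      (μ : Pseudoproduct k H L) (_ : μ.IsLie) (N : ℕ) (a : Module.Basis (Fin N) H L)
      (m : ℕ) (h l : Fin N → Fin N → Fin N → Fin m → H)
      (_ : ∀ i j, μ.prod (a i) (a j) = ∑ p, ∑ q, ptmul (h i j p q) (l i j p q) (a p)),
      ∃ a' : Module.Basis (Fin N) H (PDual k H L),
        (∀ i j, (a' i).1 (a j) = ptmul 1 1 (Triv.of k H (if i = j then 1 else 0))) ∧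
        (∃! δ : PDual k H L →ₗ[k] PDual k H L ⊗[k] PDual k H L, IsDualCobracket a' h l δ) ∧
        ∀ δ : PDual k H L →ₗ[k] PDual k H L ⊗[k] PDual k H L,
          IsDualCobracket a' h l δ → IsLieCoalgebra (H := H) δ) ∧
    (∀ {R : Type*} [AddCommGroup R] [Module k R] [Module H R] [IsScalarTower k H R]
      [Module.Finite H R] (δ : R →ₗ[k] R ⊗[k] R) (_ : IsLieCoalgebra (H := H) δ),
      (∃! br : PDual k H R →ₗ[k] X k H →ₗ[k] PDual k H R →ₗ[k] PDual k H R,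
        IsDualBracket δ br) ∧
      ∀ br : PDual k H R →ₗ[k] X k H →ₗ[k] PDual k H R →ₗ[k] PDual k H R,
        IsDualBracket δ br →
          IsLieConformal br ∧
          ∃! μ : Pseudoproduct k H (PDual k H R),
            μ.IsLie ∧ ∀ f x g, μ.xbracket f x g = br f x g) :=
  ⟨fun μ hμ N a m h l hhl => dual_of_isLie μ hμ N a m h l hhl,
    fun δ hδ => dual_of_isLieCoalgebra δ hδ⟩
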